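/- **Setting.** Let $d\ge 1$ and let $f$ be a probability density on $\mathbb R^d$ with compact support $\mathcal X$ (so $f=0$ off $\mathcal X$). $B(x,r)$ is the closed ball, $M+B(0,r)=\{x:\inf_{y\in M}\|x-y\|\le r\}$, $\mu$ is Lebesgue measure, and $L_f(\lambda)=\{x\in\mathcal X:f(x)\ge\lambda\}$. Fix $0<\beta<1$. A *cluster-core* is a closed connected set $M\subset\mathcal X$ that is a connected component of $\{x\in\mathcal X: f(x)\ge(1-\beta)\max_M f\}$. Let $M_1,\dots,M_C$ be the cluster-cores of $f$. The *attraction region* $\mathcal A_i$ is the set of $x\in\mathcal X$ whose gradient ascent curve ($\pi_x(0)=x$, $\pi_x'(t)=\nabla f(\pi_x(t))$, $\pi_x(t)\in\mathcal X$ for $t\ge 0$) exists and converges, as $t\to\infty$, to a point of $M_i$ (if there are several such curves from $x$, all of them do). For $R,\rho>0$ the *$(R,\rho)$-interior* $\mathcal A_i^{(R,\rho)}$ is the set of $x_0\in\mathcal A_i$ such that every path $\mathcal P$ from $x_0$ to any $y\in\partial\mathcal A_i$ satisfies $$\sup_{x\in\mathcal P}\ \inf_{x'\in B(x,R)}f(x')\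 \ge\ \sup_{x'\in B(y,R)}f(x')+\rho .$$ **Algorithms.** For a sample $X_{[n]}=\{x_1,\dots,x_n\}$ let $r_k(x)=\inf\{r>0:|B(x,r)\cap X_{[n]}|\ge k\}$ and $f_k(x)=k/(n\,v_d\,r_k(x)^d)$, with $v_d$ the volume of the unit ball. $G(\lambda)$ is the graph on $\{x\in X_{[n]}:f_k(x)\ge\lambda\}$ with an edge between $x,x'$ iff $\|x-x'\|\le\min\{r_k(x),r_k(x')\}$. *MCores* goes through the sample points in decreasing order of $f_k$; at $x_i$, with $\lambda=f_k(x_i)$, it adds the connected component of $G(\lambda-\beta\lambda)$ containing $x_i$ to the list of estimated cores if it is disjoint from all cores already in the list. *Quickshift++* runs MCores, draws an edge from each sample point $x$ outside the estimated cores to its closest sample point with a value of $f_k$ larger than $f_k(x)$, and assigns a sample point to the estimated core in which its directed path ends. **Assumptions.** 1. $f$ is continuously differentiable on $\mathcal X$ and $\inf_{\mathcal X}f\ge\lambda_0$ for some $\lambda_0>0$. 2. There is $R_0>0$ with $M_i+B(0,R_0)\subseteq\mathcal A_i$ for all $i$; moreover $\mu(\partial M_i)=0$ for all $i$. 3. For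 each $\epsilon>0$ there is $\eta>0$ such that for $0<\lambda\le\lambda'\le\|f\|_\infty$ with $|\lambda-\lambda'|<\eta$, every $x\in L_f(\lambda)$ at distance at least $\epsilon$ from $\partial L_f(\lambda)$ lies in $L_f(\lambda')$. 4. For each $r>0$ there is $\sigma>0$ such that for every connected component $A$ of any level set of $f$ that is contained in none of the $M_i$, $\mu(B(x,r)\cap A)\ge\sigma$ for all $x\in A$. **Theorem.** Under these assumptions let $0<R<R_0$, $\rho,\delta>0$, and let $k=k(n)\ge1$ satisfy $\log^2 n/k\to0$ and $k/n\to0$. Then for all sufficiently large $n$, with probability at least $1-2\delta$ over $n$ i.i.d. samples $X_{[n]}$ from $f$, the following holds (however ties in the algorithms are broken). If the cluster-cores returned by MCores with parameters $k,\beta$ are exactly $C$ sets $\widehat M_1,\dots,\widehat M_C$ with $$M_i\cap X_{[n]}\subseteq\widehat M_i\subseteq M_i+B(0,R/4)\qquad(i=1,\dots,C),$$ then, for every $i\in\{1,\dots,C\}$ and every $x\in\mathcal A_i^{(R,\rho)}\cap X_{[n]}$, Quickshift++ assigns $x$ to the cluster of $\widehat M_i$. -/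

import Mathlib

open Set Filter Topology MeasureTheory Metric

noncomputable section

/-! ### The density, its level sets and its cluster-cores -/

/-- `f` is a probability density with respect to Lebesgue measure, with compact support
`tsupport f`. -/
structure IsCompactDensity {d : ℕ} (f : EuclideanSpace ℝ (Fin d) → ℝ) : Prop where
  measurable : Measurable f
  nonneg : ∀ x, 0 ≤ f x
  lintegral_eq_one : ∫⁻ x, ENNReal.ofReal (f x) = 1
  compact_support : HasCompactSupport f

/-- The law with density `f`. -/
def densityLaw {d : ℕ} (f : EuclideanSpace ℝ (Fin d) → ℝ) :
    Measure (EuclideanSpace ℝ (Fin d)) :=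
  volume.withDensity fun x => ENNReal.ofReal (f x)

/-- `g` is a continuous gradient of `f` on the support of `f` (derivatives are taken within the
support, since `f` may jump to `0` across its boundary). Thus `∃ g, IsGradientOnSupport f g` says
that `f` is continuously differentiable on its support. -/
def IsGradientOnSupport {d : ℕ} (f : EuclideanSpace ℝ (Fin d) → ℝ)
    (g : EuclideanSpace ℝ (Fin d) → EuclideanSpace ℝ (Fin d)) : Prop :=
  ContinuousOn g (tsupport f) ∧ ∀ x ∈ tsupport f, HasGradientWithinAt f (g x) (tsupport f) x

/-- The level set `L_f(lam) = {x ∈ supp f : f x ≥ lam}`. -/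
def levelSet {d : ℕ} (f : EuclideanSpace ℝ (Fin d) → ℝ) (lam : ℝ) :
    Set (EuclideanSpace ℝ (Fin d)) :=
  {x | x ∈ tsupport f ∧ lam ≤ f x}

/-- `A` is a connected component of `S`. -/
def IsComponentOf {E : Type*} [TopologicalSpace E] (A S : Set E) : Prop :=
  ∃ x ∈ S, A = connectedComponentIn S x

/-- `M` is a cluster-core of `f` with fluctuation parameter `β`: a closed connected subset of the
support that is a connected component of `{x : f x ≥ (1 - β) max_M f}`. -/
def IsClusterCore {d : ℕ} (f : EuclideanSpace ℝ (Fin d) → ℝ) (β : ℝ)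
    (M : Set (EuclideanSpace ℝ (Fin d))) : Prop :=
  IsClosed M ∧ IsConnected M ∧ M ⊆ tsupport f ∧
    ∃ m : ℝ, IsGreatest (f '' M) m ∧ IsComponentOf M (levelSet f ((1 - β) * m))

/-! ### Gradient flow and attraction regions -/

/-- `π` is a gradient ascent curve in the support of `f` issued from `x`, defined for all
times `t ≥ 0`; `g` is the gradient of `f`. -/
def IsAscentPath {d : ℕ} (f : EuclideanSpace ℝ (Fin d) → ℝ)
    (g : EuclideanSpace ℝ (Fin d) → EuclideanSpace ℝ (Fin d))
    (x : EuclideanSpace ℝ (Fin d)) (π : ℝ → EuclideanSpace ℝ (Fin d)) : Prop :=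
  π 0 = x ∧ ∀ t : ℝ, 0 ≤ t → π t ∈ tsupport f ∧ HasDerivWithinAt π (g (π t)) (Ici 0) t

/-- The attraction region of `M`: the points of the support whose ascent curve converges to a
point of `M`. Where a merely continuous gradient admits several ascent curves from the same point,
all of them have to converge to a point of `M`. -/
def attractionRegion {d : ℕ} (f : EuclideanSpace ℝ (Fin d) → ℝ)
    (g : EuclideanSpace ℝ (Fin d) → EuclideanSpace ℝ (Fin d))
    (M : Set (EuclideanSpace ℝ (Fin d))) : Set (EuclideanSpace ℝ (Fin d)) :=
  {x | x ∈ tsupport f ∧ (∃ π, IsAscentPath f g x π) ∧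
    ∀ π, IsAscentPath f g x π → ∃ y ∈ M, Tendsto π atTop (𝓝 y)}

/-- The `(R, ρ)`-interior of `A`: the points `x₀` of `A` such that every path `γ` (in the whole
space) from `x₀` to any boundary point `y` of `A` satisfies
`sup_{x ∈ γ} inf_{B(x, R)} f ≥ sup_{B(y, R)} f + ρ`. -/
def regionInterior {d : ℕ} (f : EuclideanSpace ℝ (Fin d) → ℝ) (R ρ : ℝ)
    (A : Set (EuclideanSpace ℝ (Fin d))) : Set (EuclideanSpace ℝ (Fin d)) :=
  {x₀ | x₀ ∈ A ∧ ∀ y ∈ frontier A, ∀ γ : Path x₀ y,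
    sSup (f '' closedBall y R) + ρ ≤ ⨆ t, sInf (f '' closedBall (γ t) R)}

/-! ### Regularity of the level sets -/

/-- The `ε`-interior of `A`: the points of `A` at distance at least `ε` from its boundary. -/
def epsInterior {E : Type*} [MetricSpace E] (A : Set E) (ε : ℝ) : Set E :=
  {x | x ∈ A ∧ ∀ y ∈ frontier A, ε ≤ dist x y}

/-- Uniform continuity of the level sets. -/
def LevelSetsUniformlyContinuous {d : ℕ} (f : EuclideanSpace ℝ (Fin d) → ℝ) : Prop :=
  ∀ ε : ℝ, 0 < ε → ∃ η : ℝ, 0 < η ∧ ∀ lam lam' : ℝ, 0 < lam → lam ≤ lam' → lam' ≤ ⨆ x, f x →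
    |lam - lam'| < η → epsInterior (levelSet f lam) ε ⊆ levelSet f lam'

/-- Components of level sets that are not contained in one of the sets `M i` are uniformly thick
around each of their points. -/
def LevelSetsThick {d : ℕ} {ι : Type*} (f : EuclideanSpace ℝ (Fin d) → ℝ)
    (M : ι → Set (EuclideanSpace ℝ (Fin d))) : Prop :=
  ∀ r : ℝ, 0 < r → ∃ σ : ℝ, 0 < σ ∧ ∀ (lam : ℝ) (A : Set (EuclideanSpace ℝ (Fin d))),
    IsComponentOf A (levelSet f lam) → (∀ i, ¬ A ⊆ M i) →
      ∀ x ∈ A, ENNReal.ofReal σ ≤ volume (closedBall x r ∩ A)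

/-! ### The `k`-NN density estimator and the two algorithms

A sample is a map `X : Fin n → ℝ^d`; sample points are referred to by their indices (under a law
with a density they are almost surely pairwise distinct). -/

/-- The distance `r_k(x)` from `x` to its `k`-th nearest sample point. -/
def knnRadius {d n : ℕ} (X : Fin n → EuclideanSpace ℝ (Fin d)) (k : ℕ)
    (x : EuclideanSpace ℝ (Fin d)) : ℝ :=
  sInf {r : ℝ | 0 < r ∧ k ≤ Set.ncard {j : Fin n | X j ∈ closedBall x r}}

/-- The `k`-NN density estimator `f_k(x) = k / (n v_d r_k(x)^d)`. -/
def knnDensity {d n : ℕ} (X : Fin n → EuclideanSpace ℝ (Fin d)) (k : ℕ)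
    (x : EuclideanSpace ℝ (Fin d)) : ℝ :=
  (k : ℝ) / ((n : ℝ) * volume.real (ball (0 : EuclideanSpace ℝ (Fin d)) 1) * knnRadius X k x ^ d)

/-- The `lam`-level `G(lam)` of the mutual `k`-NN graph. -/
def mutualKnnGraph {d n : ℕ} (X : Fin n → EuclideanSpace ℝ (Fin d)) (k : ℕ) (lam : ℝ) :
    SimpleGraph {i : Fin n // lam ≤ knnDensity X k (X i)} where
  Adj i j := i ≠ j ∧
    dist (X i.1) (X j.1) ≤ min (knnRadius X k (X i.1)) (knnRadius X k (X j.1))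
  symm := ⟨fun i j h => ⟨h.1.symm, by rw [dist_comm, min_comm]; exact h.2⟩⟩
  loopless := ⟨fun _ h => h.1 rfl⟩

/-- The connected component of `G(lam)` that contains the sample point `i`. -/
def knnComponent {d n : ℕ} (X : Fin n → EuclideanSpace ℝ (Fin d)) (k : ℕ) (lam : ℝ)
    (i : Fin n) : Set (Fin n) :=
  {j | ∃ (hi : lam ≤ knnDensity X k (X i)) (hj : lam ≤ knnDensity X k (X j)),
    (mutualKnnGraph X k lam).Reachable ⟨i, hi⟩ ⟨j, hj⟩}

open Classical in
/-- One pass of the loop of MCores: at the sample point `i`, with `lam = f_k(x_i)`, the component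
of `G(lam - β lam)` containing `x_i` is added to the current family of cluster-cores if it is
disjoint from all of them. -/
def mcoresStep {d n : ℕ} (X : Fin n → EuclideanSpace ℝ (Fin d)) (k : ℕ) (β : ℝ)
    (cores : Set (Set (Fin n))) (i : Fin n) : Set (Set (Fin n)) :=
  let lam := knnDensity X k (X i)
  let A := knnComponent X k (lam - β * lam) i
  if ∀ B ∈ cores, Disjoint A B then insert A cores else cores

/-- MCores, run through the sample points in the order `τ 0, τ 1, …, τ (n - 1)`. -/
def mcores {d n : ℕ} (X : Fin n → EuclideanSpace ℝ (Fin d)) (k : ℕ) (β : ℝ)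
    (τ : Equiv.Perm (Fin n)) : Set (Set (Fin n)) :=
  (List.ofFn τ).foldl (mcoresStep X k β) ∅

/-- `τ` sorts the sample points by decreasing value of `f_k` (ties are broken arbitrarily). -/
def SortsByKnnDensity {d n : ℕ} (X : Fin n → EuclideanSpace ℝ (Fin d)) (k : ℕ)
    (τ : Equiv.Perm (Fin n)) : Prop :=
  Antitone fun i => knnDensity X k (X (τ i))

/-- `j` is a closest sample point to `i` among those with a higher value of `f_k`. -/
def IsClosestHigher {d n : ℕ} (X : Fin n → EuclideanSpace ℝ (Fin d)) (k : ℕ)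
    (i j : Fin n) : Prop :=
  knnDensity X k (X i) < knnDensity X k (X j) ∧
    ∀ l, knnDensity X k (X i) < knnDensity X k (X l) → dist (X i) (X j) ≤ dist (X i) (X l)

/-- `G` is the directed graph built by Quickshift++ from the estimated cluster-cores `cores`
(ties between closest points are broken arbitrarily): a point of a core has no outgoing edge, and
any other point has exactly one, to a closest sample point with a higher value of `f_k`. -/
def IsQuickshiftGraph {d n : ℕ} (X : Fin n → EuclideanSpace ℝ (Fin d)) (k : ℕ)
    (cores : Set (Set (Fin n))) (G : Fin n → Fin n → Prop) : Prop :=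
  ∀ i, ((∃ B ∈ cores, i ∈ B) → ∀ j, ¬ G i j) ∧
    ((¬ ∃ B ∈ cores, i ∈ B) → ∃ j, IsClosestHigher X k i j ∧ ∀ l, G i l ↔ l = j)

/-- The cluster that Quickshift++ attaches to the estimated core `B`: the sample points whose
directed path in `G` ends in `B`. -/
def quickshiftCluster {n : ℕ} (G : Fin n → Fin n → Prop) (B : Set (Fin n)) : Set (Fin n) :=
  {i | ∃ j ∈ B, Relation.ReflTransGen G i j}

end

/-!
At a local maximum of `f` inside an attraction region the constant curve is an ascent curve, so the
point lies in a core; the assumptions on the level sets make some core a neighbourhood of it. By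
compactness there is thus one `η > 0` such that `f` increases by `η` within distance `R / 2` of
every point whose `R / 2`-ball is in an attraction region and which is outside the cores.

A Chernoff bound and a union bound over the sample, which succeed because `k` dominates `log n`,
show that with high probability `f_k` is close to `f` at the sample points and the sample is dense
in the support. Then every step of Quickshift++ from a point of the above kind has length at most
`R`, and its segment stays where the infimum of `f` over `R`-balls is at most the current density.
Starting in the `(R, ρ)`-interior of a region, such steps cannot leave the region: a path crossing
its frontier this way would have to climb `ρ` above the density at which it crosses. As `f_k`
increases strictly along the steps, the walk ends, and it ends in the core of its region.
-/

theorem isPreconnected_iInter_of_antitone {E : Type*} [TopologicalSpace E] [T2Space E]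
    {A : ℕ → Set E} (hA : Antitone A) (hc : ∀ n, IsCompact (A n))
    (hp : ∀ n, IsPreconnected (A n)) : IsPreconnected (⋂ n, A n) := by
  have hcomp : IsCompact (⋂ n, A n) :=
    (hc 0).of_isClosed_subset (isClosed_iInter fun n => (hc n).isClosed) (iInter_subset _ 0)
  rw [isPreconnected_iff_subset_of_fully_disjoint_closed hcomp.isClosed]
  intro u v hu hv huv hd
  obtain ⟨U, V, hU, hV, hKU, hKV, hUV⟩ := SeparatedNhds.of_isCompact_isCompact
    (hcomp.inter_right hu) (hcomp.inter_right hv)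
    (hd.mono inter_subset_right inter_subset_right)
  have hcover : (⋂ n, A n) ⊆ U ∪ V := fun x hx =>
    (huv hx).imp (fun h => hKU ⟨hx, h⟩) fun h => hKV ⟨hx, h⟩
  obtain ⟨n, hn⟩ := exists_subset_nhds_of_isCompact hA.directed_ge hc
    fun x hx => (hU.union hV).mem_nhds (hcover hx)
  have hsub : (⋂ n, A n) ⊆ A n := iInter_subset _ _
  rcases (hp n).subset_or_subset hU hV hUV hn with h | h
  · exact Or.inl fun x hx => (huv hx).resolve_right fun hxv =>
      disjoint_left.1 hUV (h (hsub hx)) (hKV ⟨hx, hxv⟩)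
  · exact Or.inr fun x hx => (huv hx).resolve_left fun hxu =>
      disjoint_left.1 hUV (hKU ⟨hx, hxu⟩) (h (hsub hx))

theorem isClosed_connectedComponentIn {E : Type*} [TopologicalSpace E] {F : Set E}
    (hF : IsClosed F) (x : E) : IsClosed (connectedComponentIn F x) := by
  by_cases hx : x ∈ F
  · exact isClosed_of_closure_subset <|
      isPreconnected_connectedComponentIn.closure.subset_connectedComponentIn
        (subset_closure (mem_connectedComponentIn hx))
        (closure_minimal (connectedComponentIn_subset F x) hF)
  · rw [connectedComponentIn_eq_empty hx]
    exact isClosed_empty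

theorem nonempty_inter_frontier_of_isPreconnected {E : Type*} [TopologicalSpace E] {s A : Set E}
    (hs : IsPreconnected s) (hin : (s ∩ A).Nonempty) (hout : (s \ A).Nonempty) :
    (s ∩ frontier A).Nonempty := by
  by_contra! h
  have hsub : s ⊆ interior A ∪ (closure A)ᶜ := fun z hz => by
    by_contra! hz'
    exact eq_empty_iff_forall_notMem.1 h z
      ⟨hz, not_not.1 fun hc => hz' (Or.inr hc), fun hi => hz' (Or.inl hi)⟩
  have hd : Disjoint (interior A) (closure A)ᶜ :=
    disjoint_compl_right.mono_left (interior_subset.trans subset_closure)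
  obtain ⟨x, hx, hxA⟩ := hin
  obtain ⟨y, hy, hyA⟩ := hout
  rcases hs.subset_or_subset isOpen_interior isClosed_closure.isOpen_compl hd hsub with h' | h'
  · exact hyA (interior_subset (h' hy))
  · exact h' hx (subset_closure hxA)

theorem isClosed_setOf_closedBall_subset {E : Type*} [SeminormedAddCommGroup E] {S : Set E}
    (hS : IsClosed S) (r : ℝ) : IsClosed {x | closedBall x r ⊆ S} := by
  have : {x | closedBall x r ⊆ S} = ⋂ v ∈ closedBall (0 : E) r, (fun x => x + v) ⁻¹' S := by
    ext x
    simp only [mem_ofPred_eq, mem_iInter, mem_preimage, subset_def]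
    constructor
    · intro h v hv
      exact h _ (by simpa using hv)
    · intro h y hy
      simpa using h (y - x) (by simpa [dist_eq_norm] using hy)
  rw [this]
  exact isClosed_biInter fun v _ => hS.preimage (continuous_id.add continuous_const)

theorem exists_pos_forall_exists_add_le {E : Type*} [PseudoMetricSpace E] {K : Set E}
    (hK : IsCompact K) {f : E → ℝ} (hf : ContinuousOn f K) {r : ℝ}
    (h : ∀ x ∈ K, ∃ y ∈ ball x r, f x < f y) :
    ∃ η : ℝ, 0 < η ∧ ∀ x ∈ K, ∃ y ∈ ball x r, f x + η ≤ f y := by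
  suffices ∃ η : ℝ, 0 < η ∧ ∀ x ∈ K, x ∈ K → ∃ y ∈ ball x r, f x + η ≤ f y by simpa using this
  refine hK.induction_on (p := fun S => ∃ η : ℝ, 0 < η ∧ ∀ x ∈ S, x ∈ K →
    ∃ y ∈ ball x r, f x + η ≤ f y) ⟨1, one_pos, by simp⟩ ?_ ?_ fun x hx => ?_
  · exact fun S T hST ⟨η, hη, H⟩ => ⟨η, hη, fun x hx => H x (hST hx)⟩
  · rintro S T ⟨η, hη, H⟩ ⟨η', hη', H'⟩
    refine ⟨min η η', lt_min hη hη', fun x hx hxK => ?_⟩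
    rcases hx with hx | hx
    · obtain ⟨y, hy, hxy⟩ := H x hx hxK
      exact ⟨y, hy, by linarith [min_le_left η η']⟩
    · obtain ⟨y, hy, hxy⟩ := H' x hx hxK
      exact ⟨y, hy, by linarith [min_le_right η η']⟩
  · obtain ⟨y, hy, hxy⟩ := h x hx
    have hball : ball y r ∈ 𝓝[K] x :=
      mem_nhdsWithin_of_mem_nhds (isOpen_ball.mem_nhds (mem_ball_comm.1 hy))
    have hlt : ∀ᶠ z in 𝓝[K] x, f z < (f x + f y) / 2 :=
      (hf x hx).eventually (gt_mem_nhds (by linarith))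
    refine ⟨_, inter_mem hball hlt, (f y - f x) / 2, by linarith, ?_⟩
    rintro z ⟨hzy, hz⟩ -
    exact ⟨y, mem_ball_comm.1 hzy, by linarith [show f z < (f x + f y) / 2 from hz]⟩

section Density

variable {d : ℕ} {f : EuclideanSpace ℝ (Fin d) → ℝ}
  {g : EuclideanSpace ℝ (Fin d) → EuclideanSpace ℝ (Fin d)}
  {M M' : Set (EuclideanSpace ℝ (Fin d))} {x : EuclideanSpace ℝ (Fin d)} {β lam : ℝ}

theorem IsCompactDensity.bddAbove (hf : IsCompactDensity f) (hcont : ContinuousOn f (tsupport f)) :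
    BddAbove (range f) := by
  refine ((hf.compact_support.isCompact.image_of_continuousOn hcont).bddAbove.union
    (bddAbove_singleton (a := 0))).mono ?_
  rintro _ ⟨x, rfl⟩
  by_cases hx : x ∈ tsupport f
  · exact Or.inl ⟨x, hx, rfl⟩
  · exact Or.inr (image_eq_zero_of_notMem_tsupport hx)

theorem isCompact_levelSet (hsupp : HasCompactSupport f) (hcont : ContinuousOn f (tsupport f))
    (lam : ℝ) : IsCompact (levelSet f lam) :=
  hsupp.isCompact.of_isClosed_subset
    (hcont.preimage_isClosed_of_isClosed (isClosed_tsupport f) isClosed_Ici) fun _ hx => hx.1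

theorem levelSet_antitone : Antitone (levelSet f) :=
  fun _ _ h _ hx => ⟨hx.1, h.trans hx.2⟩

theorem levelSet_mem_nhds (hcont : ContinuousOn f (tsupport f)) (hx : tsupport f ∈ 𝓝 x)
    (hlam : lam < f x) : levelSet f lam ∈ 𝓝 x := by
  filter_upwards [hx, (hcont.continuousAt hx).eventually (lt_mem_nhds hlam)] with y hy hlt
  exact ⟨hy, hlt.le⟩

theorem IsClusterCore.exists_eq_connectedComponentIn (h : IsClusterCore f β M) :
    ∃ m, IsGreatest (f '' M) m ∧
      ∀ x ∈ M, M = connectedComponentIn (levelSet f ((1 - β) * m)) x := by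
  obtain ⟨-, -, -, m, hm, x₀, -, rfl⟩ := h
  exact ⟨m, hm, fun x hx => connectedComponentIn_eq hx⟩

theorem IsClusterCore.eq_of_inter_nonempty (hβ : β < 1) (h : IsClusterCore f β M)
    (h' : IsClusterCore f β M') (hne : (M ∩ M').Nonempty) : M = M' := by
  obtain ⟨m, hm, hMeq⟩ := h.exists_eq_connectedComponentIn
  obtain ⟨m', hm', hMeq'⟩ := h'.exists_eq_connectedComponentIn
  wlog hle : m ≤ m' generalizing M M' m m'
  · exact (this h' h (inter_comm M M' ▸ hne) m' hm' hMeq' m hm hMeq (le_of_not_ge hle)).symm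
  obtain ⟨z, hz, hz'⟩ := hne
  have hsub : M' ⊆ M := by
    rw [hMeq z hz, hMeq' z hz']
    exact connectedComponentIn_mono _
      (levelSet_antitone (mul_le_mul_of_nonneg_left hle (sub_nonneg.2 hβ.le)))
  have hmm : m = m' := le_antisymm hle (hm'.mono hm (image_mono hsub))
  rw [hMeq z hz, hMeq' z hz', hmm]

theorem attractionRegion_subset : attractionRegion f g M ⊆ tsupport f := fun _ h => h.1

theorem inter_nonempty_of_mem_attractionRegion (h : x ∈ attractionRegion f g M)
    (h' : x ∈ attractionRegion f g M') : (M ∩ M').Nonempty := by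
  obtain ⟨-, ⟨π, hπ⟩, hconv⟩ := h
  obtain ⟨y, hy, hlim⟩ := hconv π hπ
  obtain ⟨y', hy', hlim'⟩ := h'.2.2 π hπ
  exact ⟨y, hy, tendsto_nhds_unique hlim hlim' ▸ hy'⟩

theorem mem_of_isLocalMax (hg : HasGradientWithinAt f (g x) (tsupport f) x)
    (hx : attractionRegion f g M ∈ 𝓝 x) (hmax : IsLocalMax f x) : x ∈ M := by
  have hxA : x ∈ attractionRegion f g M := mem_of_mem_nhds hx
  have hgx : g x = 0 := by
    simpa using hmax.hasFDerivAt_eq_zero <|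
      hg.hasFDerivWithinAt.hasFDerivAt (mem_of_superset hx attractionRegion_subset)
  have hconst : IsAscentPath f g x fun _ => x :=
    ⟨rfl, fun t _ => ⟨hxA.1, by rw [hgx]; exact hasDerivWithinAt_const _ _ _⟩⟩
  obtain ⟨y, hy, hlim⟩ := hxA.2.2 _ hconst
  exact tendsto_nhds_unique tendsto_const_nhds hlim ▸ hy

theorem LevelSetsUniformlyContinuous.lt_of_mem_interior (hlev : LevelSetsUniformlyContinuous f)
    (hlam : 0 < lam) (hlt : lam < ⨆ x, f x) (hx : x ∈ interior (levelSet f lam)) : lam < f x := by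
  obtain ⟨ε, hε, hball⟩ := Metric.isOpen_iff.1 isOpen_interior x hx
  obtain ⟨η, hη, hinterior⟩ := hlev ε hε
  have hdeep : x ∈ epsInterior (levelSet f lam) ε := by
    refine ⟨interior_subset hx, fun y hy => ?_⟩
    by_contra! hxy
    exact hy.2 (hball (mem_ball'.2 hxy))
  set lam' := min (lam + η / 2) (⨆ x, f x)
  have hlam' : lam < lam' := lt_min (by linarith) hlt
  have hclose : |lam - lam'| < η := by
    rw [abs_sub_comm, abs_of_pos (sub_pos.2 hlam')]
    linarith [min_le_left (lam + η / 2) (⨆ x, f x)]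
  exact hlam'.trans_le (hinterior lam lam' hlam hlam'.le (min_le_right _ _) hclose hdeep).2

theorem iInter_connectedComponentIn_levelSet_subset (hsupp : HasCompactSupport f)
    (hcont : ContinuousOn f (tsupport f)) {u : ℕ → ℝ} (hu : Monotone u)
    (hlim : Tendsto u atTop (𝓝 lam)) (hx : x ∈ levelSet f lam) :
    ⋂ n, connectedComponentIn (levelSet f (u n)) x ⊆ connectedComponentIn (levelSet f lam) x := by
  have hxu (n : ℕ) : x ∈ levelSet f (u n) := levelSet_antitone (hu.ge_of_tendsto hlim n) hx
  refine (isPreconnected_iInter_of_antitone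
    (fun a b hab => connectedComponentIn_mono _ (levelSet_antitone (hu hab)))
    (fun n => (isCompact_levelSet hsupp hcont _).of_isClosed_subset
      (isClosed_connectedComponentIn (isCompact_levelSet hsupp hcont _).isClosed x)
      (connectedComponentIn_subset _ _))
    fun n => isPreconnected_connectedComponentIn).subset_connectedComponentIn
      (mem_iInter.2 fun n => mem_connectedComponentIn (hxu n)) fun y hy => ?_
  have hy' (n : ℕ) : y ∈ levelSet f (u n) :=
    connectedComponentIn_subset _ _ (mem_iInter.1 hy n)
  exact ⟨(hy' 0).1, le_of_tendsto' hlim fun n => (hy' n).2⟩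

variable {ι : Type*} {N : ι → Set (EuclideanSpace ℝ (Fin d))}

theorem LevelSetsThick.volume_pos (hthick : LevelSetsThick f N) (hsupp : HasCompactSupport f)
    (hcont : ContinuousOn f (tsupport f)) (hx : x ∈ levelSet f lam)
    (hN : ∀ c < lam, ∀ i, ¬ connectedComponentIn (levelSet f c) x ⊆ N i) {s : ℝ} (hs : 0 < s) :
    0 < volume (closedBall x s ∩ connectedComponentIn (levelSet f lam) x) := by
  obtain ⟨σ, hσ, hvol⟩ := hthick s hs
  obtain ⟨u, hu, hult, hlim⟩ := exists_seq_strictMono_tendsto lam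
  set A : ℕ → Set (EuclideanSpace ℝ (Fin d)) := fun n =>
    closedBall x s ∩ connectedComponentIn (levelSet f (u n)) x
  have hxu (n : ℕ) : x ∈ levelSet f (u n) := levelSet_antitone (hult n).le hx
  have hσA (n : ℕ) : ENNReal.ofReal σ ≤ volume (A n) :=
    hvol _ _ ⟨x, hxu n, rfl⟩ (hN _ (hult n)) x (mem_connectedComponentIn (hxu n))
  have hAclosed (n : ℕ) : IsClosed (A n) := isClosed_closedBall.inter
    (isClosed_connectedComponentIn (isCompact_levelSet hsupp hcont _).isClosed x)
  have hAlim : Tendsto (fun n => volume (A n)) atTop (𝓝 (volume (⋂ n, A n))) :=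
    tendsto_measure_iInter_atTop (fun n => (hAclosed n).nullMeasurableSet)
      (fun a b hab => inter_subset_inter_right _
        (connectedComponentIn_mono _ (levelSet_antitone (hu.monotone hab))))
      ⟨0, ((measure_mono inter_subset_left).trans_lt measure_closedBall_lt_top).ne⟩
  calc 0 < ENNReal.ofReal σ := ENNReal.ofReal_pos.2 hσ
    _ ≤ volume (⋂ n, A n) := ge_of_tendsto' hAlim hσA
    _ ≤ _ := measure_mono <| (inter_iInter _ _).symm.trans_subset <| inter_subset_inter_right _
      (iInter_connectedComponentIn_levelSet_subset hsupp hcont hu.monotone hlim hx)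

-- A local maximum lies in a core. Strictly above the level of that core the core is a
-- neighbourhood of it; at the level itself, thickness of the slightly lower components would
-- produce a set of positive measure on which `f` is at most the level, hence in the null frontier.
theorem exists_mem_nhds_of_isLocalMax (hf : IsCompactDensity f)
    (hgrad : ∀ x ∈ tsupport f, HasGradientWithinAt f (g x) (tsupport f) x)
    {lam₀ : ℝ} (hlam₀ : 0 < lam₀) (hlower : ∀ x ∈ tsupport f, lam₀ ≤ f x)
    (hβ₀ : 0 < β) (hβ₁ : β < 1) (hN : ∀ i, IsClusterCore f β (N i))
    (hN_null : ∀ i, volume (frontier (N i)) = 0) (hlev : LevelSetsUniformlyContinuous f)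
    (hthick : LevelSetsThick f N) {i : ι} (hx : attractionRegion f g (N i) ∈ 𝓝 x)
    (hmax : IsLocalMax f x) : ∃ j, N j ∈ 𝓝 x := by
  by_contra! hnot
  have hcont : ContinuousOn f (tsupport f) := fun y hy => (hgrad y hy).continuousWithinAt
  have hsupp : tsupport f ∈ 𝓝 x := mem_of_superset hx attractionRegion_subset
  have hxN : x ∈ N i := mem_of_isLocalMax (hgrad x (mem_of_mem_nhds hsupp)) hx hmax
  have hcc {c : ℝ} (hc : c < f x) : connectedComponentIn (levelSet f c) x ∈ 𝓝 x :=
    connectedComponentIn_mem_nhds (levelSet_mem_nhds hcont hsupp hc)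
  obtain ⟨m, hm, hNeq⟩ := (hN i).exists_eq_connectedComponentIn
  have hm_pos : 0 < m := hlam₀.trans_le <|
    (hlower x ((hN i).2.2.1 hxN)).trans (hm.2 (mem_image_of_mem f hxN))
  set lam := (1 - β) * m
  have hNlev : N i ⊆ levelSet f lam := hNeq x hxN ▸ connectedComponentIn_subset _ _
  have hlam : lam = f x := ((hNlev hxN).2.eq_or_lt).resolve_right fun hlt =>
    hnot i (hNeq x hxN ▸ hcc hlt)
  have hlam_lt : lam < ⨆ y, f y := by
    obtain ⟨w, -, hw⟩ := hm.1
    calc lam < m := by simp only [lam]; nlinarith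
      _ ≤ ⨆ y, f y := hw ▸ le_ciSup (hf.bddAbove hcont) w
  obtain ⟨s, hs, hball⟩ := nhds_basis_closedBall.mem_iff.1 hmax
  have hpos : 0 < volume (closedBall x s ∩ N i) := by
    rw [hNeq x hxN]
    exact hthick.volume_pos hf.compact_support hcont (hNlev hxN)
      (fun c hc j hj => hnot j (mem_of_superset (hcc (hlam ▸ hc)) hj)) hs
  have hfrontier : closedBall x s ∩ N i ⊆ frontier (N i) := by
    refine fun z hz => ⟨subset_closure hz.2, fun hzi => ?_⟩
    have hlt : lam < f z := hlev.lt_of_mem_interior (mul_pos (sub_pos.2 hβ₁) hm_pos) hlam_lt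
      (interior_mono hNlev hzi)
    have hle : f z ≤ f x := hball hz.1
    exact (hlam ▸ hlt).not_ge hle
  exact hpos.ne' (measure_mono_null hfrontier (hN_null i))

theorem exists_uniform_increase (hf : IsCompactDensity f)
    (hgrad : ∀ x ∈ tsupport f, HasGradientWithinAt f (g x) (tsupport f) x)
    {lam₀ : ℝ} (hlam₀ : 0 < lam₀) (hlower : ∀ x ∈ tsupport f, lam₀ ≤ f x)
    (hβ₀ : 0 < β) (hβ₁ : β < 1) (hN : ∀ i, IsClusterCore f β (N i))
    (hN_null : ∀ i, volume (frontier (N i)) = 0) (hlev : LevelSetsUniformlyContinuous f)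
    (hthick : LevelSetsThick f N) {r : ℝ} (hr : 0 < r) :
    ∃ η : ℝ, 0 < η ∧ ∀ i x, ball x r ⊆ attractionRegion f g (N i) → (∀ j, x ∉ N j) →
      ∃ y ∈ ball x r, f x + η ≤ f y := by
  set Y := {x | (∃ i, ball x r ⊆ attractionRegion f g (N i)) ∧ ∀ j, x ∉ N j}
  have hcont : ContinuousOn f (tsupport f) := fun y hy => (hgrad y hy).continuousWithinAt
  have hY : closure Y ⊆ tsupport f := closure_minimal
    (fun x ⟨⟨_, hi⟩, _⟩ => attractionRegion_subset (hi (mem_ball_self hr))) (isClosed_tsupport f)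
  suffices h : ∀ x ∈ closure Y, ∃ y ∈ ball x r, f x < f y by
    obtain ⟨η, hη, H⟩ := exists_pos_forall_exists_add_le
      (hf.compact_support.isCompact.of_isClosed_subset isClosed_closure hY) (hcont.mono hY) h
    exact ⟨η, hη, fun i x hi hx => H x (subset_closure ⟨⟨i, hi⟩, hx⟩)⟩
  intro x hx
  by_contra! hle
  obtain ⟨x', hx', ⟨i, hi⟩, -⟩ := mem_closure_iff_nhds.1 hx _ (ball_mem_nhds x (half_pos hr))
  have hA : attractionRegion f g (N i) ∈ 𝓝 x :=
    mem_of_superset (isOpen_ball.mem_nhds (ball_subset_ball (half_le_self hr.le)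
      (mem_ball_comm.1 hx'))) hi
  obtain ⟨j, hj⟩ := exists_mem_nhds_of_isLocalMax hf hgrad hlam₀ hlower hβ₀ hβ₁ hN hN_null hlev
    hthick hA (mem_of_superset (ball_mem_nhds x hr) hle)
  obtain ⟨z, hzj, -, hz⟩ := mem_closure_iff_nhds.1 hx _ hj
  exact hz j hzj

end Density

section Paths

/-- The sublevel set at level `c` of the eroded function `x ↦ inf f(B(x, R))`. It encodes the
left-hand side of the path condition in `regionInterior`: the supremum along a path is at most `c`
when the path stays in this set. -/
def erodedSublevel {E : Type*} [PseudoMetricSpace E] (f : E → ℝ) (R c : ℝ) : Set E :=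
  {x | sInf (f '' closedBall x R) ≤ c}

theorem erodedSublevel_mono {E : Type*} [PseudoMetricSpace E] (f : E → ℝ) (R : ℝ) :
    Monotone (erodedSublevel f R) := fun _ _ h _ hx => le_trans hx h

theorem closedBall_subset_erodedSublevel {E : Type*} [PseudoMetricSpace E] {f : E → ℝ}
    (hf : BddBelow (range f)) (R : ℝ) (x : E) : closedBall x R ⊆ erodedSublevel f R (f x) :=
  fun _ hz => csInf_le (hf.mono (image_subset_range _ _))
    (mem_image_of_mem f (mem_closedBall_comm.1 hz))

variable {d : ℕ} {f : EuclideanSpace ℝ (Fin d) → ℝ} {A : Set (EuclideanSpace ℝ (Fin d))}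
  {x₀ x y : EuclideanSpace ℝ (Fin d)} {R ρ c : ℝ}

theorem sSup_image_closedBall_add_le_of_joinedIn (hx₀ : x₀ ∈ regionInterior f R ρ A)
    (hy : y ∈ frontier A) (h : JoinedIn (erodedSublevel f R c) x₀ y) :
    sSup (f '' closedBall y R) + ρ ≤ c :=
  (hx₀.2 y hy h.somePath).trans (ciSup_le h.somePath_mem)

-- If the ball left `A`, the path could be prolonged by a segment to a frontier point `y` with
-- `x ∈ closedBall y R`. Along that segment the eroded values are at most `f y`, so the condition
-- at `y` would give `f x + ρ ≤ c`.
theorem closedBall_subset_of_joinedIn (hbelow : BddBelow (range f)) (habove : BddAbove (range f))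
    (hρ : 0 < ρ) (hx₀ : x₀ ∈ regionInterior f R ρ A) (hx : x ∈ A)
    (hjoin : JoinedIn (erodedSublevel f R c) x₀ x) (hc : c < f x + ρ) : closedBall x R ⊆ A := by
  intro w hw
  by_contra hwA
  have hR : 0 ≤ R := dist_nonneg.trans hw
  obtain ⟨y, hys, hy⟩ := nonempty_inter_frontier_of_isPreconnected
    (convex_segment x w).isPreconnected ⟨x, left_mem_segment ℝ x w, hx⟩
    ⟨w, right_mem_segment ℝ x w, hwA⟩
  have hyx : dist y x ≤ R :=
    (convex_closedBall x R).segment_subset (mem_closedBall_self hR) hw hys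
  have hsegment : segment ℝ x y ⊆ erodedSublevel f R (f y) :=
    ((convex_closedBall y R).segment_subset (mem_closedBall'.2 hyx)
      (mem_closedBall_self hR)).trans (closedBall_subset_erodedSublevel hbelow R y)
  have hjoin' : JoinedIn (erodedSublevel f R (max c (f y))) x₀ y :=
    (hjoin.mono (erodedSublevel_mono f R (le_max_left _ _))).trans
      (.of_segment_subset (hsegment.trans (erodedSublevel_mono f R (le_max_right _ _))))
  have hle_sup {z : EuclideanSpace ℝ (Fin d)} (hz : z ∈ closedBall y R) :
      f z ≤ sSup (f '' closedBall y R) :=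
    le_csSup (habove.mono (image_subset_range _ _)) (mem_image_of_mem f hz)
  have hy_le := hle_sup (mem_closedBall_self hR)
  have hx_le := hle_sup (mem_closedBall'.2 hyx)
  rcases le_max_iff.1 (sSup_image_closedBall_add_le_of_joinedIn hx₀ hy hjoin') with h | h <;>
    linarith

end Paths

section Quickshift

variable {d n k : ℕ} {X : Fin n → EuclideanSpace ℝ (Fin d)} {f : EuclideanSpace ℝ (Fin d) → ℝ}

theorem IsQuickshiftGraph.mem_quickshiftCluster {cores : Set (Set (Fin n))}
    {G : Fin n → Fin n → Prop} (hG : IsQuickshiftGraph X k cores G) {P : Fin n → Prop}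
    {B : Set (Fin n)} (hcore : ∀ a, P a → ∀ S ∈ cores, a ∈ S → a ∈ B)
    (hstep : ∀ a b, P a → (∀ S ∈ cores, a ∉ S) → IsClosestHigher X k a b → P b) {i : Fin n}
    (hi : P i) : i ∈ quickshiftCluster G B := by
  have hwf : WellFounded fun a b : Fin n => knnDensity X k (X b) < knnDensity X k (X a) :=
    Finite.wellFounded_of_trans_of_irrefl (InvImage (· > ·) fun a => knnDensity X k (X a))
  induction i using hwf.induction with
  | _ a ih =>
    by_cases ha : ∃ S ∈ cores, a ∈ S
    · obtain ⟨S, hS, haS⟩ := ha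
      exact ⟨a, hcore a hi S hS haS, .refl⟩
    · obtain ⟨b, hab, hGb⟩ := (hG a).2 ha
      obtain ⟨c, hc, hbc⟩ :=
        ih b hab.1 (hstep a b hi (fun S hS haS => ha ⟨S, hS, haS⟩) hab)
      exact ⟨c, hc, .head ((hGb b).2 rfl) hbc⟩

/-- The sample `X` is `(k, ε, r)`-representative of `f`: at its points the `k`-NN estimator is
`ε`-accurate from above, and from below at those that are `r`-deep in the support, and each
`r`-deep point of the support has a sample point within distance `r`. This is the deterministic
content of the event on which Quickshift++ is analysed. -/
structure IsRepresentative (f : EuclideanSpace ℝ (Fin d) → ℝ) (k : ℕ) (ε r : ℝ)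
    (X : Fin n → EuclideanSpace ℝ (Fin d)) : Prop where
  knnDensity_le : ∀ j, X j ∈ tsupport f → knnDensity X k (X j) ≤ f (X j) + ε
  le_knnDensity : ∀ j, closedBall (X j) r ⊆ tsupport f → f (X j) - ε ≤ knnDensity X k (X j)
  exists_dist_le : ∀ y, closedBall y r ⊆ tsupport f → ∃ j, dist (X j) y ≤ r

variable {ε r η R : ℝ}

theorem IsRepresentative.exists_knnDensity_lt (hX : IsRepresentative f k ε r X) (hr : 0 ≤ r)
    (hrR : r ≤ R / 4) (hεη : 3 * ε < η)
    (hmod : ∀ x ∈ tsupport f, ∀ y ∈ tsupport f, dist x y ≤ r → dist (f x) (f y) ≤ ε)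
    {a : Fin n} (ha : closedBall (X a) R ⊆ tsupport f) {y : EuclideanSpace ℝ (Fin d)}
    (hy : y ∈ ball (X a) (R / 2)) (hfy : f (X a) + η ≤ f y) :
    ∃ l, dist (X a) (X l) ≤ R ∧ knnDensity X k (X a) < knnDensity X k (X l) := by
  have hya : dist y (X a) < R / 2 := hy
  have hydeep : closedBall y r ⊆ tsupport f :=
    (closedBall_subset_closedBall' (by linarith)).trans ha
  obtain ⟨l, hl⟩ := hX.exists_dist_le y hydeep
  have hla : dist (X l) (X a) ≤ r + R / 2 := (dist_triangle _ y _).trans (by linarith)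
  have hldeep : closedBall (X l) r ⊆ tsupport f :=
    (closedBall_subset_closedBall' (by linarith)).trans ha
  have hupper := hX.knnDensity_le a (ha (mem_closedBall_self (by linarith)))
  have hlower := hX.le_knnDensity l hldeep
  have hclose := abs_le.1 (hmod (X l) (hldeep (mem_closedBall_self hr)) y
    (hydeep (mem_closedBall_self hr)) hl)
  exact ⟨l, by rw [dist_comm]; linarith, by linarith [hclose.1]⟩

-- The quickshift path started at `X j₀` keeps the following invariant: the current point is in
-- `A i` and is joined to `X j₀` where the eroded density does not exceed its estimated density.
theorem IsRepresentative.mem_quickshiftCluster (hX : IsRepresentative f k ε r X)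
    (hbelow : BddBelow (range f)) (habove : BddAbove (range f)) {ι : Type*}
    {M A : ι → Set (EuclideanSpace ℝ (Fin d))} (hA : ∀ i, A i ⊆ tsupport f)
    (hdisj : Pairwise (Function.onFun Disjoint A)) {ρ : ℝ} (hρ : 0 < ρ)
    (hincrease : ∀ i x, ball x (R / 2) ⊆ A i → (∀ j, x ∉ M j) →
      ∃ y ∈ ball x (R / 2), f x + η ≤ f y)
    (hr : 0 ≤ r) (hrR : r ≤ R / 4) (hεη : 3 * ε < η) (hερ : 2 * ε < ρ)
    (hmod : ∀ x ∈ tsupport f, ∀ y ∈ tsupport f, dist x y ≤ r → dist (f x) (f y) ≤ ε)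
    {Mhat : ι → Set (Fin n)} (hMhat : ∀ i, {j | X j ∈ M i} ⊆ Mhat i ∧ ∀ j ∈ Mhat i, X j ∈ A i)
    {G : Fin n → Fin n → Prop} (hG : IsQuickshiftGraph X k (range Mhat) G) {i : ι} {j₀ : Fin n}
    (hj₀ : X j₀ ∈ regionInterior f R ρ (A i)) : j₀ ∈ quickshiftCluster G (Mhat i) := by
  have hR : 0 ≤ R := by linarith
  have hself (x : EuclideanSpace ℝ (Fin d)) : x ∈ erodedSublevel f R (f x) :=
    closedBall_subset_erodedSublevel hbelow R x (mem_closedBall_self hR)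
  have hestimate {a : Fin n} (ha : closedBall (X a) R ⊆ A i) :
      f (X a) ≤ knnDensity X k (X a) + ε := by
    linarith [hX.le_knnDensity a
      ((closedBall_subset_closedBall (by linarith)).trans (ha.trans (hA i)))]
  refine hG.mem_quickshiftCluster (P := fun a => X a ∈ A i ∧
    JoinedIn (erodedSublevel f R (knnDensity X k (X a) + ε)) (X j₀) (X a)) ?_ ?_ ⟨hj₀.1, ?_⟩
  · rintro a ⟨ha, -⟩ _ ⟨i', rfl⟩ haM
    obtain rfl : i' = i := by
      by_contra hne
      exact disjoint_left.1 (hdisj hne) ((hMhat i').2 a haM) ha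
    exact haM
  · rintro a b ⟨ha, hjoin⟩ hcore hab
    have hball : closedBall (X a) R ⊆ A i := closedBall_subset_of_joinedIn hbelow habove hρ hj₀ ha
      hjoin (by linarith [hX.knnDensity_le a (hA i ha)])
    obtain ⟨y, hy, hfy⟩ := hincrease i (X a)
      (ball_subset_closedBall.trans ((closedBall_subset_closedBall (by linarith)).trans hball))
      fun j hj => hcore _ (mem_range_self j) ((hMhat j).1 hj)
    obtain ⟨l, hal, hlt⟩ := hX.exists_knnDensity_lt hr hrR hεη hmod (hball.trans (hA i)) hy hfy
    have hb : X b ∈ closedBall (X a) R := mem_closedBall'.2 ((hab.2 l hlt).trans hal)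
    have hsegment : segment ℝ (X a) (X b) ⊆ erodedSublevel f R (f (X a)) :=
      ((convex_closedBall (X a) R).segment_subset (mem_closedBall_self hR) hb).trans
        (closedBall_subset_erodedSublevel hbelow R (X a))
    exact ⟨hball hb, (hjoin.mono (erodedSublevel_mono f R (by linarith [hab.1]))).trans
      (.of_segment_subset (hsegment.trans
        (erodedSublevel_mono f R (by linarith [hab.1, hestimate hball]))))⟩
  · have hball : closedBall (X j₀) R ⊆ A i := closedBall_subset_of_joinedIn hbelow habove hρ hj₀
      hj₀.1 (.refl (hself (X j₀))) (by linarith)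
    exact .refl (erodedSublevel_mono f R (hestimate hball) (hself (X j₀)))

end Quickshift

section SampleCount

/-- The number of points of the sample `X` in `S`, counted with multiplicity. -/
noncomputable def sampleCount {κ E : Type*} (X : κ → E) (S : Set E) : ℕ :=
  Set.ncard {j | X j ∈ S}

open Classical in
theorem sampleCount_eq_sum {κ E : Type*} [Fintype κ] (X : κ → E) (S : Set E) :
    sampleCount X S = ∑ j, if X j ∈ S then 1 else 0 := by
  rw [sampleCount, Set.ncard_eq_toFinset_card', Finset.sum_boole]
  simp

theorem sampleCount_mono {κ E : Type*} [Finite κ] (X : κ → E) : Monotone (sampleCount X) :=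
  fun _ _ h => Set.ncard_le_ncard fun _ hj => h hj

theorem sampleCount_eq_one_add_of_mem {E : Type*} {m : ℕ} (X : Fin (m + 1) → E)
    (j : Fin (m + 1)) {S : Set E} (hj : X j ∈ S) :
    sampleCount X S = 1 + sampleCount (fun l => X (j.succAbove l)) S := by
  classical
  rw [sampleCount_eq_sum, sampleCount_eq_sum, Fin.sum_univ_succAbove _ j, if_pos hj]

theorem pow_sampleCount_eq_prod {κ E : Type*} [Fintype κ] (X : κ → E) (S : Set E) (w : ℝ) :
    w ^ sampleCount X S = ∏ j, (1 + S.indicator (fun _ => w - 1) (X j)) := by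
  classical
  rw [sampleCount_eq_sum, ← Finset.prod_pow_eq_pow_sum]
  refine Finset.prod_congr rfl fun j _ => ?_
  by_cases h : X j ∈ S <;> simp [h]

end SampleCount

section Chernoff

variable {κ E : Type*} [Fintype κ] [MeasurableSpace E] (μ : Measure E) [IsProbabilityMeasure μ]
  {S : Set E}

theorem integrable_pow_sampleCount (hS : MeasurableSet S) (w : ℝ) :
    Integrable (fun X => w ^ sampleCount X S) (Measure.pi fun _ : κ => μ) := by
  simp_rw [pow_sampleCount_eq_prod]
  exact Integrable.fintype_prod (f := fun _ x => 1 + S.indicator (fun _ => w - 1) x) fun _ =>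
    (integrable_const _).add ((integrable_const _).indicator hS)

theorem integral_pow_sampleCount (hS : MeasurableSet S) (w : ℝ) :
    ∫ X, w ^ sampleCount X S ∂Measure.pi (fun _ : κ => μ) =
      (1 + μ.real S * (w - 1)) ^ Fintype.card κ := by
  have hfactor : ∫ x, (1 + S.indicator (fun _ => w - 1) x) ∂μ = 1 + μ.real S * (w - 1) := by
    rw [integral_add (integrable_const _) ((integrable_const _).indicator hS),
      integral_indicator_const _ hS]
    simp
  simp_rw [pow_sampleCount_eq_prod]
  rw [integral_fintype_prod_eq_pow fun x => 1 + S.indicator (fun _ => w - 1) x, hfactor]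

-- The event is an upper tail of the count for `1 ≤ w` and a lower tail for `w ≤ 1`.
theorem measureReal_pow_le_pow_sampleCount_le (hS : MeasurableSet S) (a : ℕ) {w : ℝ}
    (hw : 0 < w) :
    (Measure.pi fun _ : κ => μ).real {X | w ^ a ≤ w ^ sampleCount X S} ≤
      Real.exp (Fintype.card κ * μ.real S * (w - 1)) / w ^ a := by
  have hmarkov := mul_meas_ge_le_integral_of_nonneg
    (.of_forall fun X => (pow_pos hw (sampleCount X S)).le)
    (integrable_pow_sampleCount (κ := κ) μ hS w) (w ^ a)
  rw [integral_pow_sampleCount μ hS] at hmarkov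
  rw [le_div_iff₀' (pow_pos hw a)]
  have hbase : 0 ≤ 1 + μ.real S * (w - 1) := by
    nlinarith [measureReal_nonneg (μ := μ) (s := S), measureReal_le_one (μ := μ) (s := S)]
  calc w ^ a * (Measure.pi fun _ : κ => μ).real {X | w ^ a ≤ w ^ sampleCount X S}
      ≤ (1 + μ.real S * (w - 1)) ^ Fintype.card κ := hmarkov
    _ ≤ Real.exp (μ.real S * (w - 1)) ^ Fintype.card κ := by
        gcongr
        linarith [Real.add_one_le_exp (μ.real S * (w - 1))]
    _ = Real.exp (Fintype.card κ * μ.real S * (w - 1)) := by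
        rw [← Real.exp_nat_mul, mul_assoc]

theorem measureReal_le_one_add_sampleCount_le (hS : MeasurableSet S) {k : ℕ} {e : ℝ}
    (he : 0 < e) (he1 : e < 1) (h : Fintype.card κ * μ.real S ≤ (1 - e) * k) :
    (Measure.pi fun _ : κ => μ).real {X | k ≤ 1 + sampleCount X S} ≤
      (1 - e)⁻¹ * (Real.exp e * (1 - e)) ^ k := by
  have h1e : 0 < 1 - e := by linarith
  have hw : 1 ≤ (1 - e)⁻¹ := (one_le_inv₀ h1e).2 (by linarith)
  have hexp : Fintype.card κ * μ.real S * ((1 - e)⁻¹ - 1) ≤ k * e :=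
    calc _ ≤ (1 - e) * k * ((1 - e)⁻¹ - 1) := by gcongr
      _ = k * e := by field_simp; ring
  calc _ ≤ (Measure.pi fun _ : κ => μ).real
        {X | (1 - e)⁻¹ ^ (k - 1) ≤ (1 - e)⁻¹ ^ sampleCount X S} :=
        measureReal_mono fun X (hX : k ≤ _) => pow_le_pow_right₀ hw (by omega)
    _ ≤ _ := measureReal_pow_le_pow_sampleCount_le μ hS _ (inv_pos.2 h1e)
    _ ≤ Real.exp (k * e) * (1 - e) ^ (k - 1) := by
        rw [inv_pow, div_inv_eq_mul]
        gcongr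
    _ ≤ Real.exp e ^ k * ((1 - e)⁻¹ * (1 - e) ^ k) := by
        rw [Real.exp_nat_mul]
        gcongr
        rw [le_inv_mul_iff₀ h1e, ← pow_succ']
        exact pow_le_pow_of_le_one h1e.le (by linarith) (by omega)
    _ = _ := by rw [mul_pow]; ring

theorem measureReal_one_add_sampleCount_lt_le (hS : MeasurableSet S) {k : ℕ} {e : ℝ}
    (he : 0 < e) (h : (1 + e) * k ≤ (Fintype.card κ + 1) * μ.real S) :
    (Measure.pi fun _ : κ => μ).real {X | 1 + sampleCount X S < k} ≤
      Real.exp 1 * (Real.exp (-e) * (1 + e)) ^ k := by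
  have h1e : 0 < 1 + e := by linarith
  have hw : (1 + e)⁻¹ ≤ 1 := inv_le_one_of_one_le₀ (by linarith)
  have hexp : Fintype.card κ * μ.real S * ((1 + e)⁻¹ - 1) ≤ 1 + k * -e := by
    have hmass : (1 + e) * k - 1 ≤ Fintype.card κ * μ.real S := by
      linarith [measureReal_le_one (μ := μ) (s := S)]
    calc _ ≤ ((1 + e) * k - 1) * ((1 + e)⁻¹ - 1) :=
          mul_le_mul_of_nonpos_right hmass (by linarith)
      _ = 1 - (1 + e)⁻¹ + k * -e := by field_simp; ring
      _ ≤ _ := by linarith [inv_pos.2 h1e]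
  calc _ ≤ (Measure.pi fun _ : κ => μ).real
        {X | (1 + e)⁻¹ ^ k ≤ (1 + e)⁻¹ ^ sampleCount X S} :=
        measureReal_mono fun X (hX : _ < k) =>
          pow_le_pow_of_le_one (inv_pos.2 h1e).le hw (by omega)
    _ ≤ _ := measureReal_pow_le_pow_sampleCount_le μ hS _ (inv_pos.2 h1e)
    _ ≤ Real.exp (1 + k * -e) * (1 + e) ^ k := by
        rw [inv_pow, div_inv_eq_mul]
        gcongr
    _ = _ := by rw [Real.exp_add, Real.exp_nat_mul, mul_pow, mul_assoc]

theorem exp_mul_one_sub_lt_one {e : ℝ} (he : e ≠ 0) : Real.exp e * (1 - e) < 1 := by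
  rw [← lt_div_iff₀' (Real.exp_pos e), one_div, ← Real.exp_neg]
  linarith [Real.add_one_lt_exp (neg_ne_zero.2 he)]

end Chernoff

section CenteredBalls

theorem measure_pi_removeNth_le {E : Type*} [MeasurableSpace E] (μ : Measure E)
    [IsProbabilityMeasure μ] {m : ℕ} (j : Fin (m + 1)) {T : Set (E × (Fin m → E))}
    (hT : MeasurableSet T) {q : ENNReal}
    (h : ∀ x, (Measure.pi fun _ : Fin m => μ) {Y | (x, Y) ∈ T} ≤ q) :
    (Measure.pi fun _ : Fin (m + 1) => μ) {X | (X j, fun l => X (j.succAbove l)) ∈ T} ≤ q := by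
  calc _ = (μ.prod (Measure.pi fun _ : Fin m => μ)) T :=
        (measurePreserving_piFinSuccAbove (fun _ : Fin (m + 1) => μ) j).measure_preimage
          hT.nullMeasurableSet
    _ ≤ ∫⁻ _, q ∂μ := (Measure.prod_apply hT).trans_le (lintegral_mono h)
    _ = q := by simp

-- The exponent wins because `log n` is eventually at most `-(log q / 2) * k n`, so that
-- `q ^ k n` is at most `n ^ (-2)`.
theorem tendsto_nat_mul_pow_zero {k : ℕ → ℕ}
    (hk : (fun n : ℕ => Real.log n) =o[atTop] fun n => (k n : ℝ)) {q : ℝ} (hq : 0 < q)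
    (hq1 : q < 1) : Tendsto (fun n : ℕ => (n : ℝ) * q ^ k n) atTop (𝓝 0) := by
  have hL : Real.log q < 0 := Real.log_neg hq hq1
  refine squeeze_zero' (.of_forall fun n => by positivity) ?_ tendsto_one_div_atTop_nhds_zero_nat
  filter_upwards [hk.bound (show 0 < -Real.log q / 2 by linarith), eventually_gt_atTop 0]
    with n hlog hn
  have hn' : (0 : ℝ) < n := by exact_mod_cast hn
  rw [Real.norm_natCast] at hlog
  have hpow : q ^ k n ≤ ((n : ℝ) ^ 2)⁻¹ := by
    rw [← Real.log_le_log_iff (by positivity) (by positivity), Real.log_pow, Real.log_inv,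
      Real.log_pow]
    push_cast
    linarith [Real.le_norm_self (Real.log n)]
  calc (n : ℝ) * q ^ k n ≤ n * ((n : ℝ) ^ 2)⁻¹ := by gcongr
    _ = 1 / n := by field_simp

variable {E : Type*} [PseudoMetricSpace E] [SecondCountableTopology E] [MeasurableSpace E]
  [BorelSpace E]

theorem measurable_sampleCount_closedBall {κ : Type*} [Finite κ] {s : E → ℝ}
    (hs : Measurable s) :
    Measurable fun p : E × (κ → E) => sampleCount p.2 (closedBall p.1 (s p.1)) := by
  classical
  have := Fintype.ofFinite κ
  simp_rw [sampleCount_eq_sum]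
  refine Finset.measurable_sum _ fun l _ => Measurable.ite ?_ measurable_const measurable_const
  exact measurableSet_le (f := fun p : E × (κ → E) => dist (p.2 l) p.1)
    (g := fun p => s p.1) (by fun_prop) (by fun_prop)

variable (μ : Measure E) [IsProbabilityMeasure μ] {K : Set E}

theorem measure_exists_sampleCount_closedBall_mem_le {m : ℕ} {s : E → ℝ} (hs : Measurable s)
    (hs0 : ∀ x ∈ K, 0 ≤ s x) (hK : MeasurableSet K) (P : Set ℕ) {q : ℝ}
    (h : ∀ x ∈ K, (Measure.pi fun _ : Fin m => μ).real
      {Y | 1 + sampleCount Y (closedBall x (s x)) ∈ P} ≤ q) :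
    (Measure.pi fun _ : Fin (m + 1) => μ)
      {X | ∃ j, X j ∈ K ∧ sampleCount X (closedBall (X j) (s (X j))) ∈ P} ≤
      ENNReal.ofReal ((m + 1 : ℕ) * q) := by
  let T : Set (E × (Fin m → E)) :=
    {p | p.1 ∈ K ∧ 1 + sampleCount p.2 (closedBall p.1 (s p.1)) ∈ P}
  have hT : MeasurableSet T := (measurable_fst hK).inter
    ((measurable_const.add (measurable_sampleCount_closedBall hs))
      (MeasurableSet.of_discrete (s := P)))
  have hj (j : Fin (m + 1)) : (Measure.pi fun _ : Fin (m + 1) => μ)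
      {X | X j ∈ K ∧ sampleCount X (closedBall (X j) (s (X j))) ∈ P} ≤ ENNReal.ofReal q := by
    refine (measure_mono ?_).trans (measure_pi_removeNth_le μ j hT fun x => ?_)
    · rintro X ⟨hXK, hXP⟩
      refine ⟨hXK, ?_⟩
      rwa [← sampleCount_eq_one_add_of_mem X j (mem_closedBall_self (hs0 _ hXK))]
    · by_cases hx : x ∈ K
      · simpa [T, hx] using (ENNReal.le_ofReal_iff_toReal_le (measure_ne_top _ _)
          (measureReal_nonneg.trans (h x hx))).2 (h x hx)
      · simp [T, hx]
  rw [ofPred_exists]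
  calc _ ≤ ∑ _j : Fin (m + 1), ENNReal.ofReal q :=
        (measure_iUnion_fintype_le _ _).trans (Finset.sum_le_sum fun j _ => hj j)
    _ = _ := by
      rw [Finset.sum_const, Finset.card_univ, Fintype.card_fin, nsmul_eq_mul,
        ENNReal.ofReal_mul (by positivity), ENNReal.ofReal_natCast]

variable {s : ℕ → E → ℝ} {k : ℕ → ℕ}

theorem tendsto_measure_exists_sampleCount_closedBall_mem (hs : ∀ n, Measurable (s n))
    (hs0 : ∀ n, ∀ x ∈ K, 0 ≤ s n x) (hK : MeasurableSet K) {P : ℕ → Set ℕ}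
    (hk : (fun n : ℕ => Real.log n) =o[atTop] fun n => (k n : ℝ)) {c q : ℝ} (hq : 0 < q)
    (hq1 : q < 1)
    (h : ∀ᶠ m in atTop, ∀ x ∈ K, (Measure.pi fun _ : Fin m => μ).real
      {Y | 1 + sampleCount Y (closedBall x (s (m + 1) x)) ∈ P (m + 1)} ≤ c * q ^ k (m + 1)) :
    Tendsto (fun n => (Measure.pi fun _ : Fin n => μ)
      {X | ∃ j, X j ∈ K ∧ sampleCount X (closedBall (X j) (s n (X j))) ∈ P n}) atTop (𝓝 0) := by
  rw [← tendsto_add_atTop_iff_nat 1]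
  have hlim : Tendsto (fun m : ℕ => ENNReal.ofReal ((m + 1 : ℕ) * (c * q ^ k (m + 1)))) atTop
      (𝓝 0) := by
    have := ((tendsto_add_atTop_iff_nat 1).2 (tendsto_nat_mul_pow_zero hk hq hq1)).const_mul c
    simpa only [mul_zero, ENNReal.ofReal_zero, mul_left_comm] using ENNReal.tendsto_ofReal this
  refine tendsto_of_tendsto_of_tendsto_of_le_of_le' tendsto_const_nhds hlim
    (.of_forall fun _ => zero_le) (h.mono fun m hm => ?_)
  exact measure_exists_sampleCount_closedBall_mem_le μ (hs _) (hs0 _) hK _ hm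

theorem tendsto_measure_exists_le_sampleCount_closedBall (hs : ∀ n, Measurable (s n))
    (hs0 : ∀ n, ∀ x ∈ K, 0 ≤ s n x) (hK : MeasurableSet K)
    (hk : (fun n : ℕ => Real.log n) =o[atTop] fun n => (k n : ℝ)) {e : ℝ} (he : 0 < e)
    (he1 : e < 1)
    (h : ∀ᶠ n : ℕ in atTop, ∀ x ∈ K, n * μ.real (closedBall x (s n x)) ≤ (1 - e) * k n) :
    Tendsto (fun n => (Measure.pi fun _ : Fin n => μ)
      {X | ∃ j, X j ∈ K ∧ k n ≤ sampleCount X (closedBall (X j) (s n (X j)))})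
      atTop (𝓝 0) := by
  refine tendsto_measure_exists_sampleCount_closedBall_mem μ hs hs0 hK (P := fun n => Ici (k n))
    hk (c := (1 - e)⁻¹) (mul_pos (Real.exp_pos e) (by linarith))
    (exp_mul_one_sub_lt_one he.ne') ?_
  filter_upwards [(tendsto_add_atTop_nat 1).eventually h] with m hm x hx
  refine measureReal_le_one_add_sampleCount_le μ measurableSet_closedBall he he1 ?_
  refine le_trans ?_ (hm x hx)
  rw [Fintype.card_fin]
  gcongr
  exact m.le_succ

theorem tendsto_measure_exists_sampleCount_closedBall_lt (hs : ∀ n, Measurable (s n))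
    (hs0 : ∀ n, ∀ x ∈ K, 0 ≤ s n x) (hK : MeasurableSet K)
    (hk : (fun n : ℕ => Real.log n) =o[atTop] fun n => (k n : ℝ)) {e : ℝ} (he : 0 < e)
    (h : ∀ᶠ n : ℕ in atTop, ∀ x ∈ K, (1 + e) * k n ≤ n * μ.real (closedBall x (s n x))) :
    Tendsto (fun n => (Measure.pi fun _ : Fin n => μ)
      {X | ∃ j, X j ∈ K ∧ sampleCount X (closedBall (X j) (s n (X j))) < k n})
      atTop (𝓝 0) := by
  refine tendsto_measure_exists_sampleCount_closedBall_mem μ hs hs0 hK (P := fun n => Iio (k n))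
    hk (c := Real.exp 1) (q := Real.exp (-e) * (1 + e)) (by positivity)
    (by simpa using exp_mul_one_sub_lt_one (neg_ne_zero.2 he.ne')) ?_
  filter_upwards [(tendsto_add_atTop_nat 1).eventually h] with m hm x hx
  refine measureReal_one_add_sampleCount_lt_le μ measurableSet_closedBall he ?_
  simpa using hm x hx

end CenteredBalls

theorem tendsto_measure_exists_forall_lt_dist {E : Type*} [PseudoMetricSpace E]
    [MeasurableSpace E] [OpensMeasurableSpace E] (μ : Measure E) [IsProbabilityMeasure μ]
    {K : Set E} (hK : IsCompact K) (hKμ : K ⊆ μ.support) {r : ℝ} (hr : 0 < r) :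
    Tendsto (fun n => (Measure.pi fun _ : Fin n => μ) {X | ∃ y ∈ K, ∀ j, r < dist (X j) y})
      atTop (𝓝 0) := by
  refine hK.induction_on (p := fun s => Tendsto (fun n => (Measure.pi fun _ : Fin n => μ)
    {X | ∃ y ∈ s, ∀ j, r < dist (X j) y}) atTop (𝓝 0)) (by simp) (fun s t hst ht => ?_)
    (fun s t hs ht => ?_) fun x hx => ⟨ball x (r / 2), mem_nhdsWithin_of_mem_nhds
      (ball_mem_nhds x (half_pos hr)), ?_⟩
  · refine tendsto_of_tendsto_of_tendsto_of_le_of_le tendsto_const_nhds ht (fun _ => zero_le)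
      fun n => measure_mono fun X hX => ?_
    exact hX.imp fun y hy => ⟨hst hy.1, hy.2⟩
  · refine tendsto_of_tendsto_of_tendsto_of_le_of_le tendsto_const_nhds
      (by simpa only [add_zero] using hs.add ht) (fun _ => zero_le) fun n =>
      (measure_mono ?_).trans (measure_union_le _ _)
    rintro X ⟨y, hy | hy, hXy⟩
    exacts [.inl ⟨y, hy, hXy⟩, .inr ⟨y, hy, hXy⟩]
  · have hlt : μ (ball x (r / 2))ᶜ < 1 := by
      rw [prob_compl_eq_one_sub measurableSet_ball]
      exact ENNReal.sub_lt_self ENNReal.one_ne_top one_ne_zero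
        ((Measure.mem_support_iff_forall x).1 (hKμ hx) _ (ball_mem_nhds x (half_pos hr))).ne'
    refine tendsto_of_tendsto_of_tendsto_of_le_of_le tendsto_const_nhds
      (ENNReal.tendsto_pow_atTop_nhds_zero_of_lt_one hlt) (fun _ => zero_le) fun n => ?_
    calc _ ≤ (Measure.pi fun _ : Fin n => μ) (univ.pi fun _ => (ball x (r / 2))ᶜ) := by
          refine measure_mono ?_
          rintro X ⟨y, hy, hXy⟩ j - hj
          linarith [hXy j, dist_triangle_right (X j) y x, mem_ball.1 hj, mem_ball.1 hy]
      _ = _ := by simp [Measure.pi_pi]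

section KNearestNeighbours

variable {d n k : ℕ} {X : Fin n → EuclideanSpace ℝ (Fin d)} {x : EuclideanSpace ℝ (Fin d)}

theorem knnRadius_le {s : ℝ} (hs : 0 < s) (h : k ≤ sampleCount X (closedBall x s)) :
    knnRadius X k x ≤ s :=
  csInf_le ⟨0, fun _ hr => hr.1.le⟩ ⟨hs, h⟩

theorem le_knnRadius {s t : ℝ} (hs : 0 < s) (hks : k ≤ sampleCount X (closedBall x s))
    (htk : sampleCount X (closedBall x t) < k) : t ≤ knnRadius X k x := by
  refine le_csInf ⟨s, hs, hks⟩ fun r hr => ?_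
  by_contra! hlt
  exact (htk.trans_le hr.2).not_ge (sampleCount_mono X (closedBall_subset_closedBall hlt.le))

theorem volume_real_unitBall_pos (d : ℕ) :
    0 < volume.real (ball (0 : EuclideanSpace ℝ (Fin d)) 1) :=
  ENNReal.toReal_pos (measure_ball_pos _ _ one_pos).ne' measure_ball_lt_top.ne

/-- The radius of the balls of volume `k / (n y)`, that is, the value of `knnRadius` for which
`knnDensity` is `y`. -/
noncomputable def volumeRadius (d n k : ℕ) (y : ℝ) : ℝ :=
  (k / (n * volume.real (ball (0 : EuclideanSpace ℝ (Fin d)) 1) * y)) ^ (d : ℝ)⁻¹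

theorem measurable_volumeRadius (d n k : ℕ) : Measurable (volumeRadius d n k) := by
  unfold volumeRadius
  fun_prop

theorem volumeRadius_nonneg (d n k : ℕ) {y : ℝ} (hy : 0 ≤ y) : 0 ≤ volumeRadius d n k y := by
  unfold volumeRadius
  positivity

theorem volumeRadius_pos (hn : 0 < n) (hk : 0 < k) {y : ℝ} (hy : 0 < y) :
    0 < volumeRadius d n k y := by
  have := volume_real_unitBall_pos d
  unfold volumeRadius
  positivity

theorem volumeRadius_pow (hd : 0 < d) (n k : ℕ) {y : ℝ} (hy : 0 ≤ y) :
    volumeRadius d n k y ^ d =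
      k / (n * volume.real (ball (0 : EuclideanSpace ℝ (Fin d)) 1) * y) := by
  rw [volumeRadius, Real.rpow_inv_natCast_pow (by positivity) hd.ne']

theorem volume_real_closedBall_volumeRadius (hd : 0 < d) (n k : ℕ) {y : ℝ} (hy : 0 ≤ y)
    (x : EuclideanSpace ℝ (Fin d)) :
    volume.real (closedBall x (volumeRadius d n k y)) = k / (n * y) := by
  have hv := (volume_real_unitBall_pos d).ne'
  rw [Measure.addHaar_real_closedBall _ _ (volumeRadius_nonneg d n k hy), finrank_euclideanSpace,
    Fintype.card_fin, volumeRadius_pow hd n k hy]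
  field_simp

theorem div_mul_volumeRadius_pow (hd : 0 < d) (hn : 0 < n) (hk : 0 < k) {y : ℝ} (hy : 0 < y) :
    k / (n * volume.real (ball (0 : EuclideanSpace ℝ (Fin d)) 1) * volumeRadius d n k y ^ d) =
      y := by
  have hv := volume_real_unitBall_pos d
  rw [volumeRadius_pow hd n k hy.le]
  field_simp

theorem knnDensity_le (hd : 0 < d) {y : ℝ} (hy : 0 < y)
    (h : sampleCount X (closedBall x (volumeRadius d n k y)) < k) : knnDensity X k x ≤ y := by
  have hv := volume_real_unitBall_pos d
  have hk : 0 < k := (Nat.zero_le _).trans_lt h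
  rcases n.eq_zero_or_pos with rfl | hn
  · simpa [knnDensity] using hy.le
  have hpos : 0 < volumeRadius d n k y := volumeRadius_pos hn hk hy
  by_cases! hne : ∃ s > 0, k ≤ sampleCount X (closedBall x s)
  · obtain ⟨s, hs, hks⟩ := hne
    have hle : volumeRadius d n k y ≤ knnRadius X k x := le_knnRadius hs hks h
    rw [← div_mul_volumeRadius_pow hd hn hk hy, knnDensity]
    gcongr
  · have hempty : {r | 0 < r ∧ k ≤ Set.ncard {j | X j ∈ closedBall x r}} = ∅ :=
      eq_empty_of_forall_notMem fun r hr => (hne r hr.1).not_ge hr.2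
    rw [knnDensity, knnRadius, hempty, Real.sInf_empty, zero_pow hd.ne', mul_zero, div_zero]
    exact hy.le

-- The second count excludes a zero `knnRadius`, for which the quotient `knnDensity` is zero.
theorem le_knnDensity (hd : 0 < d) {y t : ℝ} (hy : 0 < y) (ht : 0 < t)
    (h : k ≤ sampleCount X (closedBall x (volumeRadius d n k y)))
    (h' : sampleCount X (closedBall x t) < k) : y ≤ knnDensity X k x := by
  have hv := volume_real_unitBall_pos d
  have hk : 0 < k := (Nat.zero_le _).trans_lt h'
  obtain ⟨j, -⟩ : {j | X j ∈ closedBall x (volumeRadius d n k y)}.Nonempty :=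
    Set.nonempty_of_ncard_ne_zero (hk.trans_le h).ne'
  have hn : 0 < n := j.pos
  have hpos : 0 < volumeRadius d n k y := volumeRadius_pos hn hk hy
  have hle : knnRadius X k x ≤ volumeRadius d n k y := knnRadius_le hpos h
  have hradius : 0 < knnRadius X k x := ht.trans_le (le_knnRadius hpos h h')
  rw [← div_mul_volumeRadius_pow hd hn hk hy, knnDensity]
  gcongr

theorem eventually_volumeRadius_le (hd : 0 < d) {k : ℕ → ℕ}
    (hk : (fun n => (k n : ℝ)) =o[atTop] fun n : ℕ => (n : ℝ)) {y₀ s : ℝ} (hy₀ : 0 < y₀)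
    (hs : 0 < s) : ∀ᶠ n in atTop, ∀ y ≥ y₀, volumeRadius d n (k n) y ≤ s := by
  have hv := volume_real_unitBall_pos d
  filter_upwards [hk.bound
    (show 0 < volume.real (ball (0 : EuclideanSpace ℝ (Fin d)) 1) * y₀ * s ^ d by positivity),
    eventually_gt_atTop 0] with n hkn hn y hy
  have hn' : (0 : ℝ) < n := by exact_mod_cast hn
  have hypos : 0 < y := hy₀.trans_le hy
  rw [Real.norm_natCast, Real.norm_natCast] at hkn
  refine le_of_pow_le_pow_left₀ hd.ne' hs.le ?_
  rw [volumeRadius_pow hd n (k n) hypos.le, div_le_iff₀ (by positivity)]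
  calc (k n : ℝ) ≤ volume.real (ball (0 : EuclideanSpace ℝ (Fin d)) 1) * y₀ * s ^ d * n := hkn
    _ ≤ volume.real (ball (0 : EuclideanSpace ℝ (Fin d)) 1) * y * s ^ d * n := by gcongr
    _ = _ := by ring

end KNearestNeighbours

section DensityLaw

variable {d : ℕ} {f : EuclideanSpace ℝ (Fin d) → ℝ} {S : Set (EuclideanSpace ℝ (Fin d))}

theorem IsCompactDensity.isProbabilityMeasure (hf : IsCompactDensity f) :
    IsProbabilityMeasure (densityLaw f) := ⟨by
  rw [densityLaw, withDensity_apply _ MeasurableSet.univ, setLIntegral_univ, hf.lintegral_eq_one]⟩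

theorem densityLaw_real_le (hS : MeasurableSet S) (hSv : volume S ≠ ⊤) {c : ℝ} (hc : 0 ≤ c)
    (h : ∀ x ∈ S, f x ≤ c) : (densityLaw f).real S ≤ c * volume.real S := by
  rw [measureReal_def, densityLaw, withDensity_apply _ hS, measureReal_def,
    ← ENNReal.toReal_ofReal hc, ← ENNReal.toReal_mul]
  refine ENNReal.toReal_mono (ENNReal.mul_ne_top ENNReal.ofReal_ne_top hSv) ?_
  rw [← setLIntegral_const]
  exact setLIntegral_mono measurable_const fun x hx => ENNReal.ofReal_le_ofReal (h x hx)

theorem IsCompactDensity.le_densityLaw_real (hf : IsCompactDensity f) (hS : MeasurableSet S)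
    {c : ℝ} (hc : 0 ≤ c) (h : ∀ x ∈ S, c ≤ f x) :
    c * volume.real S ≤ (densityLaw f).real S := by
  have := hf.isProbabilityMeasure
  rw [measureReal_def, measureReal_def, ← ENNReal.toReal_ofReal hc, ← ENNReal.toReal_mul]
  refine ENNReal.toReal_mono (measure_ne_top _ _) ?_
  rw [densityLaw, withDensity_apply _ hS, ← setLIntegral_const]
  exact setLIntegral_mono hf.measurable.ennreal_ofReal fun x hx => ENNReal.ofReal_le_ofReal (h x hx)

theorem IsCompactDensity.interior_tsupport_subset_support_densityLaw (hf : IsCompactDensity f)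
    (hpos : ∀ x ∈ tsupport f, 0 < f x) : interior (tsupport f) ⊆ (densityLaw f).support := by
  intro x hx
  rw [Measure.mem_support_iff_forall]
  intro U hU
  refine pos_iff_ne_zero.2 fun hzero => ?_
  have hvol : 0 < volume (interior (tsupport f) ∩ interior U) :=
    (isOpen_interior.inter isOpen_interior).measure_pos _ ⟨x, hx, mem_interior_iff_mem_nhds.2 hU⟩
  rw [densityLaw, withDensity_apply_eq_zero hf.measurable.ennreal_ofReal] at hzero
  refine hvol.ne' (measure_mono_null (fun z hz => ?_) hzero)
  exact ⟨(ENNReal.ofReal_pos.2 (hpos z (interior_subset hz.1))).ne', interior_subset hz.2⟩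

theorem IsCompactDensity.tendsto_measure_exists_closedBall_subset_forall_lt_dist
    (hf : IsCompactDensity f) (hpos : ∀ x ∈ tsupport f, 0 < f x) {r : ℝ} (hr : 0 < r) :
    Tendsto (fun n => (Measure.pi fun _ : Fin n => densityLaw f)
      {X | ∃ y ∈ {y | closedBall y r ⊆ tsupport f}, ∀ j, r < dist (X j) y}) atTop (𝓝 0) := by
  have := hf.isProbabilityMeasure
  have hdeep {y : EuclideanSpace ℝ (Fin d)} (hy : closedBall y r ⊆ tsupport f) :
      y ∈ interior (tsupport f) :=
    mem_interior_iff_mem_nhds.2 (mem_of_superset (closedBall_mem_nhds y hr) hy)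
  exact tendsto_measure_exists_forall_lt_dist _
    (hf.compact_support.isCompact.of_isClosed_subset
      (isClosed_setOf_closedBall_subset (isClosed_tsupport f) r)
      fun y hy => interior_subset (hdeep hy))
    (fun y hy => hf.interior_tsupport_subset_support_densityLaw hpos (hdeep hy)) hr

variable {y : EuclideanSpace ℝ (Fin d) → ℝ} {K : Set (EuclideanSpace ℝ (Fin d))} {y₀ s e : ℝ}
  {k : ℕ → ℕ}

theorem IsCompactDensity.tendsto_measure_exists_le_sampleCount (hd : 0 < d)
    (hf : IsCompactDensity f) (hy : Measurable y) (hK : MeasurableSet K) (hy₀ : 0 < y₀)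
    (hyK : ∀ x ∈ K, y₀ ≤ y x) (hs : 0 < s) (he : 0 < e) (he1 : e < 1)
    (hfy : ∀ x ∈ K, ∀ z ∈ closedBall x s, f z ≤ (1 - e) * y x)
    (hk_log : (fun n : ℕ => Real.log n) =o[atTop] fun n => (k n : ℝ))
    (hk_n : (fun n => (k n : ℝ)) =o[atTop] fun n : ℕ => (n : ℝ)) :
    Tendsto (fun n => (Measure.pi fun _ : Fin n => densityLaw f) {X | ∃ j, X j ∈ K ∧
      k n ≤ sampleCount X (closedBall (X j) (volumeRadius d n (k n) (y (X j))))})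
      atTop (𝓝 0) := by
  have := hf.isProbabilityMeasure
  refine tendsto_measure_exists_le_sampleCount_closedBall (densityLaw f)
    (s := fun n x => volumeRadius d n (k n) (y x))
    (fun n => (measurable_volumeRadius d n (k n)).comp hy)
    (fun n x hx => volumeRadius_nonneg d n (k n) (hy₀.le.trans (hyK x hx))) hK hk_log he he1 ?_
  filter_upwards [eventually_volumeRadius_le hd hk_n hy₀ hs, eventually_gt_atTop 0]
    with n hradius hn x hx
  have hypos : 0 < y x := hy₀.trans_le (hyK x hx)
  have hlaw := densityLaw_real_le (f := f) measurableSet_closedBall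
    measure_closedBall_lt_top.ne (mul_nonneg (by linarith) hypos.le)
    fun z hz => hfy x hx z (closedBall_subset_closedBall (hradius _ (hyK x hx)) hz)
  rw [volume_real_closedBall_volumeRadius hd n (k n) hypos.le] at hlaw
  calc _ ≤ n * ((1 - e) * y x * (k n / (n * y x))) := by gcongr
    _ = (1 - e) * k n := by field_simp

theorem IsCompactDensity.tendsto_measure_exists_sampleCount_lt (hd : 0 < d)
    (hf : IsCompactDensity f) (hy : Measurable y) (hK : MeasurableSet K) (hy₀ : 0 < y₀)
    (hyK : ∀ x ∈ K, y₀ ≤ y x) (hs : 0 < s) (he : 0 < e)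
    (hfy : ∀ x ∈ K, ∀ z ∈ closedBall x s, (1 + e) * y x ≤ f z)
    (hk_log : (fun n : ℕ => Real.log n) =o[atTop] fun n => (k n : ℝ))
    (hk_n : (fun n => (k n : ℝ)) =o[atTop] fun n : ℕ => (n : ℝ)) :
    Tendsto (fun n => (Measure.pi fun _ : Fin n => densityLaw f) {X | ∃ j, X j ∈ K ∧
      sampleCount X (closedBall (X j) (volumeRadius d n (k n) (y (X j)))) < k n})
      atTop (𝓝 0) := by
  have := hf.isProbabilityMeasure
  refine tendsto_measure_exists_sampleCount_closedBall_lt (densityLaw f)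
    (s := fun n x => volumeRadius d n (k n) (y x))
    (fun n => (measurable_volumeRadius d n (k n)).comp hy)
    (fun n x hx => volumeRadius_nonneg d n (k n) (hy₀.le.trans (hyK x hx))) hK hk_log he ?_
  filter_upwards [eventually_volumeRadius_le hd hk_n hy₀ hs, eventually_gt_atTop 0]
    with n hradius hn x hx
  have hypos : 0 < y x := hy₀.trans_le (hyK x hx)
  have hlaw := hf.le_densityLaw_real (S := closedBall x (volumeRadius d n (k n) (y x)))
    measurableSet_closedBall (c := (1 + e) * y x) (by positivity)
    fun z hz => hfy x hx z (closedBall_subset_closedBall (hradius _ (hyK x hx)) hz)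
  rw [volume_real_closedBall_volumeRadius hd n (k n) hypos.le] at hlaw
  calc (1 + e) * k n = n * ((1 + e) * y x * (k n / (n * y x))) := by field_simp
    _ ≤ _ := by gcongr

end DensityLaw

section Representative

variable {d : ℕ} {f : EuclideanSpace ℝ (Fin d) → ℝ} {ε r : ℝ} {k : ℕ → ℕ}

theorem IsCompactDensity.exists_multiplicative_modulus (hf : IsCompactDensity f)
    (hcont : ContinuousOn f (tsupport f)) (hε : 0 < ε) :
    ∃ s > 0, ∃ e > 0, e < 1 ∧
      (∀ x ∈ tsupport f, ∀ z ∈ closedBall x s, f z ≤ (1 - e) * (f x + ε)) ∧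
      ∀ x ∈ tsupport f, ∀ z ∈ closedBall x s ∩ tsupport f, (1 + e) * (f x - ε) ≤ f z := by
  obtain ⟨B, hB⟩ := hf.bddAbove hcont
  have hfB (x : EuclideanSpace ℝ (Fin d)) : f x ≤ B := hB (mem_range_self x)
  have hB0 : 0 ≤ B := (hf.nonneg 0).trans (hfB 0)
  obtain ⟨s, hs, hmod⟩ := Metric.uniformContinuousOn_iff_le.1
    (hf.compact_support.isCompact.uniformContinuousOn_of_continuous hcont) (ε / 2) (by positivity)
  have hrel {t : ℝ} (ht : t ≤ B + ε) : ε / (2 * (B + ε)) * t ≤ ε / 2 :=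
    calc _ ≤ ε / (2 * (B + ε)) * (B + ε) := by gcongr
      _ = ε / 2 := by field_simp
  refine ⟨s, hs, ε / (2 * (B + ε)), by positivity, by rw [div_lt_one] <;> linarith,
    fun x hx z hz => ?_, fun x hx z hz => ?_⟩
  · suffices f z ≤ f x + ε / 2 by linarith [hrel (show f x + ε ≤ B + ε by linarith [hfB x])]
    by_cases hzX : z ∈ tsupport f
    · linarith [(abs_le.1 (hmod z hzX x hx hz)).2]
    · rw [image_eq_zero_of_notMem_tsupport hzX]
      linarith [hf.nonneg x]
  · linarith [hrel (show f x - ε ≤ B + ε by linarith [hfB x]),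
      (abs_le.1 (hmod z hz.2 x hx hz.1)).1]

theorem IsCompactDensity.tendsto_measure_not_isRepresentative (hd : 0 < d)
    (hf : IsCompactDensity f) (hcont : ContinuousOn f (tsupport f)) {lam₀ : ℝ} (hlam₀ : 0 < lam₀)
    (hlower : ∀ x ∈ tsupport f, lam₀ ≤ f x) (hε : 0 < ε) (hεlam : ε < lam₀) (hr : 0 < r)
    (hk_log : (fun n : ℕ => Real.log n) =o[atTop] fun n => (k n : ℝ))
    (hk_n : (fun n => (k n : ℝ)) =o[atTop] fun n : ℕ => (n : ℝ)) :
    Tendsto (fun n : ℕ => (Measure.pi fun _ : Fin n => densityLaw f)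
      {X | ¬ IsRepresentative f (k n) ε r X}) atTop (𝓝 0) := by
  obtain ⟨s, hs, e, he, he1, hupper, hlow⟩ := hf.exists_multiplicative_modulus hcont hε
  have hdeep {x : EuclideanSpace ℝ (Fin d)} (hx : closedBall x r ⊆ tsupport f) :
      x ∈ tsupport f := hx (mem_closedBall_self hr.le)
  have hfε (x : EuclideanSpace ℝ (Fin d)) : ε ≤ f x + ε := le_add_of_nonneg_left (hf.nonneg x)
  have hfar := hf.tendsto_measure_exists_closedBall_subset_forall_lt_dist
    (fun x hx => hlam₀.trans_le (hlower x hx)) hr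
  have hmany := hf.tendsto_measure_exists_le_sampleCount hd (hf.measurable.add_const ε)
    (isClosed_tsupport f).measurableSet hε (fun x _ => hfε x) hs he he1 hupper hk_log hk_n
  have hfew := hf.tendsto_measure_exists_sampleCount_lt hd (hf.measurable.sub_const ε)
    (isClosed_setOf_closedBall_subset (isClosed_tsupport f) r).measurableSet (sub_pos.2 hεlam)
    (fun x hx => sub_le_sub_right (hlower x (hdeep hx)) ε) (lt_min hs hr) he
    (fun x hx z hz => hlow x (hdeep hx) z ⟨closedBall_subset_closedBall (min_le_left s r) hz,
      hx (closedBall_subset_closedBall (min_le_right s r) hz)⟩) hk_log hk_n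
  refine tendsto_of_tendsto_of_tendsto_of_le_of_le tendsto_const_nhds
    (by simpa only [add_zero] using (hfar.add hmany).add hfew) (fun _ => zero_le) fun n =>
    (measure_mono fun X hX => ?_).trans ((measure_union_le _ _).trans
      (add_le_add_left (measure_union_le _ _) _))
  contrapose! hX
  simp only [mem_union, mem_ofPred_eq, not_or, not_exists, not_and, not_forall, not_le, not_lt]
    at hX
  obtain ⟨⟨hnear, hfew⟩, hmany⟩ := hX
  rw [mem_ofPred_eq, not_not]
  refine ⟨fun j hj => knnDensity_le hd (hε.trans_le (hfε _)) (hfew j hj), fun j hj => ?_, hnear⟩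
  have hk : 0 < k n := (Nat.zero_le _).trans_lt (hfew j (hdeep hj))
  exact le_knnDensity hd (by linarith [hlower _ (hdeep hj)])
    (volumeRadius_pos j.pos hk (hε.trans_le (hfε (X j)))) (hmany j hj) (hfew j (hdeep hj))

end Representative

theorem exists_eventually_measurableSet_of_tendsto_measure {Ω : ℕ → Type*}
    [∀ n, MeasurableSpace (Ω n)] {P : ∀ n, Measure (Ω n)} [∀ n, IsProbabilityMeasure (P n)]
    {good : ∀ n, Ω n → Prop} (h : Tendsto (fun n => P n {X | ¬ good n X}) atTop (𝓝 0))
    {δ : ENNReal} (hδ : 0 < δ) :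
    ∀ᶠ n in atTop, ∃ S : Set (Ω n), MeasurableSet S ∧ 1 - δ ≤ P n S ∧ ∀ X ∈ S, good n X := by
  filter_upwards [h.eventually (ge_mem_nhds hδ)] with n hn
  refine ⟨(toMeasurable (P n) {X | ¬ good n X})ᶜ, (measurableSet_toMeasurable _ _).compl, ?_,
    fun X hX => ?_⟩
  · rw [prob_compl_eq_one_sub (measurableSet_toMeasurable _ _), measure_toMeasurable]
    exact tsub_le_tsub_left hn 1
  · by_contra hbad
    exact hX (subset_toMeasurable _ _ hbad)

theorem pairwise_disjoint_attractionRegion {d : ℕ} {f : EuclideanSpace ℝ (Fin d) → ℝ}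
    {g : EuclideanSpace ℝ (Fin d) → EuclideanSpace ℝ (Fin d)} {β : ℝ} (hβ : β < 1) {ι : Type*}
    {M : ι → Set (EuclideanSpace ℝ (Fin d))} (hM_inj : Function.Injective M)
    (hM : ∀ i, IsClusterCore f β (M i)) :
    Pairwise (Function.onFun Disjoint fun i => attractionRegion f g (M i)) := by
  refine fun i j hij => Set.disjoint_left.2 fun x hi hj => hij (hM_inj ?_)
  exact (hM i).eq_of_inter_nonempty hβ (hM j) (inter_nonempty_of_mem_attractionRegion hi hj)

theorem isLittleO_log_of_tendsto_log_sq_div {k : ℕ → ℕ} (hk_pos : ∀ n, 0 < k n)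
    (h : Tendsto (fun n : ℕ => Real.log n ^ 2 / (k n : ℝ)) atTop (𝓝 0)) :
    (fun n : ℕ => Real.log n) =o[atTop] fun n => (k n : ℝ) := by
  refine Asymptotics.IsBigO.trans_isLittleO (.of_bound 1 ?_)
    ((Asymptotics.isLittleO_iff_tendsto fun n hn => ?_).2 h)
  · filter_upwards [(Real.tendsto_log_atTop.comp tendsto_natCast_atTop_atTop).eventually_ge_atTop 1]
      with n (hn : 1 ≤ Real.log n)
    rw [one_mul, norm_pow]
    exact le_self_pow₀ (hn.trans (Real.le_norm_self _)) two_ne_zero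
  · exact absurd hn (by exact_mod_cast (hk_pos n).ne')

theorem theorem2_general {d : ℕ} (hd : 0 < d) {f : EuclideanSpace ℝ (Fin d) → ℝ}
    (hf : IsCompactDensity f) {gradf : EuclideanSpace ℝ (Fin d) → EuclideanSpace ℝ (Fin d)}
    (hgrad : ∀ x ∈ tsupport f, HasGradientWithinAt f (gradf x) (tsupport f) x)
    {lam₀ : ℝ} (hlam₀ : 0 < lam₀) (hlower : ∀ x ∈ tsupport f, lam₀ ≤ f x)
    {β : ℝ} (hβ₀ : 0 < β) (hβ₁ : β < 1)
    {ι : Type*} {M : ι → Set (EuclideanSpace ℝ (Fin d))} (hM_inj : Function.Injective M)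
    (hM : ∀ i, IsClusterCore f β (M i)) (hM_null : ∀ i, volume (frontier (M i)) = 0)
    (hlev : LevelSetsUniformlyContinuous f) (hthick : LevelSetsThick f M)
    {R ρ : ℝ} (hR : 0 < R) (hρ : 0 < ρ) {k : ℕ → ℕ}
    (hk_log : (fun n : ℕ => Real.log n) =o[atTop] fun n => (k n : ℝ))
    (hk_n : Tendsto (fun n : ℕ => (k n : ℝ) / (n : ℝ)) atTop (𝓝 0))
    {δ : ENNReal} (hδ : 0 < δ) :
    ∃ N : ℕ, ∀ n ≥ N, ∃ Ω : Set (Fin n → EuclideanSpace ℝ (Fin d)),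
      MeasurableSet Ω ∧ 1 - δ ≤ Measure.pi (fun _ : Fin n => densityLaw f) Ω ∧
      ∀ X ∈ Ω, ∀ Mhat : ι → Set (Fin n),
        (∀ i, {j | X j ∈ M i} ⊆ Mhat i ∧
          ∀ j ∈ Mhat i, X j ∈ attractionRegion f gradf (M i)) →
        ∀ G : Fin n → Fin n → Prop, IsQuickshiftGraph X (k n) (Set.range Mhat) G →
          ∀ (i : ι) (j : Fin n),
            X j ∈ regionInterior f R ρ (attractionRegion f gradf (M i)) →
              j ∈ quickshiftCluster G (Mhat i) := by
  have hcont : ContinuousOn f (tsupport f) := fun x hx => (hgrad x hx).continuousWithinAt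
  have hk_small : (fun n => (k n : ℝ)) =o[atTop] fun n : ℕ => (n : ℝ) :=
    (Asymptotics.isLittleO_iff_tendsto' ((eventually_ne_atTop 0).mono fun n hn h =>
      absurd h (Nat.cast_ne_zero.2 hn))).2 hk_n
  have := hf.isProbabilityMeasure
  obtain ⟨η, hη, hincrease⟩ := exists_uniform_increase hf hgrad hlam₀ hlower hβ₀ hβ₁ hM hM_null
    hlev hthick (half_pos hR)
  obtain ⟨ε, hε, hεmin⟩ := exists_between
    (lt_min (lt_min (show 0 < η / 3 by positivity) (half_pos hρ)) hlam₀)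
  obtain ⟨⟨hεη, hερ⟩, hεlam⟩ := by simpa only [lt_min_iff] using hεmin
  obtain ⟨s, hs, hmod⟩ := Metric.uniformContinuousOn_iff_le.1
    (hf.compact_support.isCompact.uniformContinuousOn_of_continuous hcont) ε hε
  have hr : 0 < min s (R / 4) := lt_min hs (by positivity)
  obtain ⟨N, hN⟩ := eventually_atTop.1 (exists_eventually_measurableSet_of_tendsto_measure
    (hf.tendsto_measure_not_isRepresentative hd hcont hlam₀ hlower hε hεlam hr hk_log hk_small) hδ)
  refine ⟨N, fun n hn => (hN n hn).imp fun Ω => .imp_right (.imp_right fun hΩ => ?_)⟩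
  intro X hX Mhat hMhat G hG i j hj
  exact (hΩ X hX).mem_quickshiftCluster ⟨0, forall_mem_range.2 hf.nonneg⟩ (hf.bddAbove hcont)
    (fun _ => attractionRegion_subset) (pairwise_disjoint_attractionRegion hβ₁ hM_inj hM) hρ
    hincrease hr.le (min_le_right _ _) (by linarith) (by linarith)
    (fun x hx y hy hxy => hmod x hx y hy (hxy.trans (min_le_left _ _))) hMhat hG hj

theorem theorem2 {d : ℕ} (hd : 0 < d)
    (f : EuclideanSpace ℝ (Fin d) → ℝ) (hf : IsCompactDensity f)
    -- `f` is continuously differentiable and bounded below on its support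
    (gradf : EuclideanSpace ℝ (Fin d) → EuclideanSpace ℝ (Fin d))
    (hgrad : IsGradientOnSupport f gradf)
    (lam₀ : ℝ) (hlam₀ : 0 < lam₀) (hlower : ∀ x ∈ tsupport f, lam₀ ≤ f x)
    -- `M 0, …, M (C - 1)` are the cluster-cores of `f`
    (β : ℝ) (hβ₀ : 0 < β) (hβ₁ : β < 1)
    (C : ℕ) (M : Fin C → Set (EuclideanSpace ℝ (Fin d)))
    (hM_inj : Function.Injective M) (hM : Set.range M = {S | IsClusterCore f β S})
    (hM_null : ∀ i, volume (frontier (M i)) = 0)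
    -- the cluster-cores are in the interior of their attraction regions
    (R₀ : ℝ) (hR₀ : 0 < R₀)
    (hinterior : ∀ i, Metric.cthickening R₀ (M i) ⊆ attractionRegion f gradf (M i))
    -- regularity of the level sets
    (hcont : LevelSetsUniformlyContinuous f) (hthick : LevelSetsThick f M)
    (R ρ δ : ℝ) (hR : 0 < R) (hRR₀ : R < R₀) (hρ : 0 < ρ) (hδ : 0 < δ)
    (k : ℕ → ℕ) (hk_pos : ∀ n, 0 < k n)
    (hk_log : Tendsto (fun n : ℕ => Real.log n ^ 2 / (k n : ℝ)) atTop (𝓝 0))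
    (hk_n : Tendsto (fun n : ℕ => (k n : ℝ) / (n : ℝ)) atTop (𝓝 0)) :
    ∃ N : ℕ, ∀ n ≥ N, ∃ Ω : Set (Fin n → EuclideanSpace ℝ (Fin d)),
      MeasurableSet Ω ∧
      1 - ENNReal.ofReal (2 * δ) ≤ Measure.pi (fun _ : Fin n => densityLaw f) Ω ∧
      ∀ X ∈ Ω, ∀ τ : Equiv.Perm (Fin n), SortsByKnnDensity X (k n) τ →
        ∀ Mhat : Fin C → Set (Fin n), Function.Injective Mhat →
          Set.range Mhat = mcores X (k n) β τ →
          (∀ i, {j | X j ∈ M i} ⊆ Mhat i ∧ ∀ j ∈ Mhat i, X j ∈ Metric.cthickening (R / 4) (M i)) →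
          ∀ G : Fin n → Fin n → Prop, IsQuickshiftGraph X (k n) (mcores X (k n) β τ) G →
            ∀ (i : Fin C) (j : Fin n),
              X j ∈ regionInterior f R ρ (attractionRegion f gradf (M i)) →
                j ∈ quickshiftCluster G (Mhat i) := by
  obtain ⟨N, hN⟩ := theorem2_general hd hf hgrad.2 hlam₀ hlower hβ₀ hβ₁ hM_inj
    (fun i => hM.subset (mem_range_self i)) hM_null hcont hthick hR hρ
    (isLittleO_log_of_tendsto_log_sq_div hk_pos hk_log) hk_n
    (δ := ENNReal.ofReal (2 * δ)) (by simpa)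
  refine ⟨N, fun n hn => (hN n hn).imp fun Ω => .imp_right (.imp_right fun hΩ => ?_)⟩
  intro X hX τ _ Mhat _ hcores hMhat G hG
  exact hΩ X hX Mhat (fun i => ⟨(hMhat i).1, fun j hj => hinterior i
    (cthickening_mono (by linarith) (M i) ((hMhat i).2 j hj))⟩) G (hcores ▸ hG)
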